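/- There is a universal constant $C>0$ such that the following holds. Let $d\ge 2$, let $A\in\mathbb{R}^{d\times d}$ be symmetric with smallest eigenvalue $-\gamma$ and $\ell_2$-operator norm $\beta=\|A\|$, let $b\in\mathbb{R}^d$ and $\rho>0$, and let $s$ be a global minimizer of $$f(x)=\tfrac12 x^{\top}Ax+b^{\top}x+\tfrac{\rho}{3}\|x\|^3 .$$ Put $L_s=\beta+2\rho\|s\|$, let $0<\varepsilon\le L_s\|s\|^2$ and $\delta>0$, and set $$R=\frac{\beta}{2\rho}+\sqrt{\Big(\frac{\beta}{2\rho}\Big)^2+\frac{\|b\|}{\rho}},\qquad \eta=\frac{1}{4(\beta+\rho R)},\qquad \sigma=\frac{\rho\,\varepsilon}{12(\beta+2\rho\|s\|)} .$$ Let $q$ be uniformly distributed on the unit sphere of $\mathbb{R}^d$, $\tilde b=b+\sigma q$, and let $\tilde x_t$ be the iterates of gradient descent with step size $\eta$ on $\tilde f(x)=\frac12x^{\top}Ax+\tilde b^{\top}x+\frac{\rho}{3}\|x\|^3$, that is $\tilde x_{t+1}=\tilde x_t-\eta\nabla\tilde f(\tilde x_t)$, started at $\tilde x_0=-r\,\tilde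 b/\|\tilde b\|$, where $r$ (possibly random) satisfies $$0\le r\le \tilde R_c=\frac{-\tilde b^{\top}A\tilde b}{2\rho\|\tilde b\|^2}+\sqrt{\Big(\frac{\tilde b^{\top}A\tilde b}{2\rho\|\tilde b\|^2}\Big)^2+\frac{\|\tilde b\|}{\rho}} .$$ Then with probability at least $1-\delta$, $f(\tilde x_t)\le f(s)+\varepsilon$ for all integers $t\ge 0$ with $$t\ \ge\ C\cdot\min\left\{\frac{L_s}{\rho\|s\|-\gamma},\ \frac{L_s\|s\|^2}{\varepsilon}\right\}\cdot\log\left[\Big(1+\mathbf 1_{\{\gamma>0\}}\frac{d}{\delta}\Big)\frac{L_s\|s\|^2}{\varepsilon}\right],$$ where the first term of the minimum is read as $+\infty$ if $\rho\|s\|=\gamma$. -/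

import Mathlib

open MeasureTheory ProbabilityTheory

noncomputable section

namespace CubicGD

/-- `ℝ^d` with the Euclidean norm. -/
abbrev E (d : ℕ) : Type := EuclideanSpace ℝ (Fin d)

variable {d : ℕ}

/-- The objective `f(x) = ½ xᵀ A x + bᵀ x + (ρ/3) ‖x‖³`. -/
def objective (A : Matrix (Fin d) (Fin d) ℝ) (b : E d) (ρ : ℝ) (x : E d) : ℝ :=
  1 / 2 * inner ℝ x (Matrix.toEuclideanCLM (𝕜 := ℝ) A x) + inner ℝ b x + ρ / 3 * ‖x‖ ^ 3

/-- `γ = -λ⁽¹⁾(A)`, minus the smallest eigenvalue of the real symmetric matrix `A` (for real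
matrices, Hermitian means symmetric). -/
def gam (A : Matrix (Fin d) (Fin d) ℝ) (hA : A.IsHermitian) : ℝ :=
  -(⨅ i, hA.eigenvalues i)

/-- `β = ‖A‖`, the `ℓ₂`-operator norm of `A`. -/
def opNorm (A : Matrix (Fin d) (Fin d) ℝ) : ℝ :=
  ‖Matrix.toEuclideanCLM (𝕜 := ℝ) A‖

/-- `R = β/(2ρ) + √((β/(2ρ))² + ‖b‖/ρ)`. -/
def radius (A : Matrix (Fin d) (Fin d) ℝ) (b : E d) (ρ : ℝ) : ℝ :=
  opNorm A / (2 * ρ) + √((opNorm A / (2 * ρ)) ^ 2 + ‖b‖ / ρ)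

/-- The Cauchy radius
`R_c = -bᵀAb/(2ρ‖b‖²) + √((bᵀAb/(2ρ‖b‖²))² + ‖b‖/ρ)`. -/
def cauchyRadius (A : Matrix (Fin d) (Fin d) ℝ) (b : E d) (ρ : ℝ) : ℝ :=
  -(inner ℝ b (Matrix.toEuclideanCLM (𝕜 := ℝ) A b)) / (2 * ρ * ‖b‖ ^ 2) +
    √((inner ℝ b (Matrix.toEuclideanCLM (𝕜 := ℝ) A b) / (2 * ρ * ‖b‖ ^ 2)) ^ 2 + ‖b‖ / ρ)

/-- The step size `η = 1/(4(β + ρR))`. -/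
def stepSize (A : Matrix (Fin d) (Fin d) ℝ) (b : E d) (ρ : ℝ) : ℝ :=
  1 / (4 * (opNorm A + ρ * radius A b ρ))

/-- Gradient descent on `g` with fixed step size `η`, started at `x₀`. -/
def gradIter (g : E d → ℝ) (η : ℝ) (x₀ : E d) : ℕ → E d
  | 0 => x₀
  | t + 1 => gradIter g η x₀ t - η • gradient g (gradIter g η x₀ t)

/-- `L_s = β + 2ρ‖s‖`. -/
def smoothness (A : Matrix (Fin d) (Fin d) ℝ) (ρ : ℝ) (s : E d) : ℝ :=
  opNorm A + 2 * ρ * ‖s‖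

/-- The size of the perturbation, `σ = (ρε/(β + 2ρ‖s‖)) · (σ̄/12)`. -/
def sigma (A : Matrix (Fin d) (Fin d) ℝ) (ρ : ℝ) (s : E d) (ε σbar : ℝ) : ℝ :=
  ρ * ε / (opNorm A + 2 * ρ * ‖s‖) * (σbar / 12)

/-- The uniform probability distribution on the unit sphere of `ℝ^d`: the normalized surface
measure. -/
def uniformSphere (d : ℕ) : Measure (Metric.sphere (0 : E d) 1) :=
  ((volume : Measure (E d)).toSphere Set.univ)⁻¹ • (volume : Measure (E d)).toSphere

/-- The iterates `x̃_t` of gradient descent on `½ xᵀ A x + b̃ᵀ x + (ρ/3) ‖x‖³`, with step size `η`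
and initialization `x̃₀ = -r b̃/‖b̃‖`. -/
def iterate (A : Matrix (Fin d) (Fin d) ℝ) (btilde : E d) (ρ η r : ℝ) (t : ℕ) : E d :=
  gradIter (objective A btilde ρ) η (-((r / ‖btilde‖) • btilde)) t

/-- `min {L_s/(ρ‖s‖ - γ), L_s‖s‖²/ε} · log[(1 + 1_{γ>0} d/δ) · L_s‖s‖²/ε]`. A global minimizer
satisfies `ρ‖s‖ ≥ γ`; if `ρ‖s‖ = γ`, the first term of the minimum is `+∞`. -/
def iterBound (A : Matrix (Fin d) (Fin d) ℝ) (hA : A.IsHermitian) (ρ : ℝ) (s : E d)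
    (ε δ : ℝ) : ℝ :=
  (if gam A hA < ρ * ‖s‖ then
      min (smoothness A ρ s / (ρ * ‖s‖ - gam A hA)) (smoothness A ρ s * ‖s‖ ^ 2 / ε)
    else smoothness A ρ s * ‖s‖ ^ 2 / ε) *
  Real.log ((1 + if 0 < gam A hA then (d : ℝ) / δ else 0) * (smoothness A ρ s * ‖s‖ ^ 2 / ε))

end CubicGD

end

/-! In the eigenbasis of `A` the iterates have coordinates `-z i` times those of the perturbed
vector `b̃`. All `z i` start equal and evolve by `z i ↦ z i + η (1 - (λ i + ρ‖x‖) z i)`. The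
equations are coupled only through `‖x‖`, and `Admissible` is an invariant of this system. It makes
the norms nondecreasing, and `Admissible.sq_le` then keeps them below `2‖s‖`.

Let `γ` be minus the smallest eigenvalue. For any `μ > 0`, while `ρ‖x‖ < γ - μ` the coordinate along
a bottom eigenvector grows by a factor of at least `1 + ημ` per step. Since the norm is monotone,
this regime ends for good after about `(L_s/μ) log(...)` steps (`exists_growth_time`), where the
logarithm involves the inverse of the component of `b̃` along that eigenvector. The perturbation is
there to bound this component below: a band of the sphere of half-width `τ` has probability at most
of order `d√τ` (`uniformSphere_band_le`), so it is at least of order `σδ²/d²` off an event of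
probability `δ`. The loss of `√τ` against the true order costs only a constant, because it sits
inside a logarithm. If `γ ≤ 0` there is no growth phase and no `d/δ`.

Once `ρ‖x‖ ≥ γ - μ`, the objective behaves as if it were convex towards `s`, up to an error `μ‖x -
s‖²/2`: the product `⟨∇f̃(x), x - s⟩` dominates the gap `f̃(x) - f̃(s)`. Hence `‖x - s‖² + 2η (f̃(x)
- f̃(s))` decreases. With `μ` of order `ε/‖s‖²` it drops by at least `ηε` per step, which gives the
rate `L_s‖s‖²/ε`. With `μ = (ρ‖s‖ - γ)/2` it contracts geometrically, which gives the rate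
`L_s/(ρ‖s‖ - γ)`. Both hold as long as the accuracy `ε` has not been reached, and `σ` is so small
that replacing `f̃` by `f` costs at most `ε/8`. The two phases are added in
`objective_le_of_iterBound_le`. -/

namespace CubicGD

/-! ### Gradient descent in spectral coordinates: monotone norms and an a priori bound. -/

section SpectralDynamics

variable {ι : Type*} [Fintype ι]

/-- In the eigenbasis, a point `x = -∑ i, z i • b i • v i` of norm `n` has gradient
`-∑ i, slack i • b i • v i`. -/
def slack (lam : ι → ℝ) (ρ n : ℝ) (z : ι → ℝ) (i : ι) : ℝ := 1 - (lam i + ρ * n) * z i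

/-- The invariant behind the monotonicity of the norms of the iterates: the nonnegative part of
`slack / z` decreases as the eigenvalue grows, and moving along the negative gradient does not
decrease the norm. -/
structure Admissible (w lam : ι → ℝ) (ρ n : ℝ) (z : ι → ℝ) : Prop where
  nonneg : ∀ i, 0 ≤ z i
  slack_nonneg : ∀ i j, lam i ≤ lam j → 0 ≤ slack lam ρ n z j → 0 ≤ slack lam ρ n z i
  ratio : ∀ i j, lam i ≤ lam j → 0 ≤ slack lam ρ n z j →
    slack lam ρ n z j * z i ≤ slack lam ρ n z i * z j
  sum_nonneg : 0 ≤ ∑ i, w i * z i * slack lam ρ n z i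

/-- A function whose nonnegativity passes to smaller eigenvalues changes sign at most once along the
spectrum. This gives Chebyshev-type inequalities: a weight decreasing in the eigenvalue can be
replaced by its value at `k`, which only lowers the weighted sum of `g`. -/
lemma exists_crossing [Nonempty ι] (lam g : ι → ℝ)
    (h : ∀ i j, lam i ≤ lam j → 0 ≤ g j → 0 ≤ g i) :
    ∃ k, ∀ i, 0 ≤ g i * (lam k - lam i) := by
  classical
  by_cases hP : (Finset.univ.filter fun i => 0 ≤ g i).Nonempty
  · obtain ⟨k, hk, hmax⟩ := Finset.exists_max_image _ lam hP
    refine ⟨k, fun i => ?_⟩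
    rw [Finset.mem_filter] at hk
    rcases le_or_gt 0 (g i) with hi | hi
    · exact mul_nonneg hi (sub_nonneg.2 (hmax i (by simp [hi])))
    · have : lam k < lam i := by
        by_contra hc
        exact absurd (h i k (not_lt.1 hc) hk.2) (not_le.2 hi)
      nlinarith
  · obtain ⟨k, -, hmin⟩ := Finset.exists_min_image Finset.univ lam Finset.univ_nonempty
    refine ⟨k, fun i => ?_⟩
    have hi : g i < 0 := by
      by_contra hc
      exact hP ⟨i, by simp [not_lt.1 hc]⟩
    nlinarith [hmin i (Finset.mem_univ i)]

lemma admissible_const {w lam : ι → ℝ} {ρ n c : ℝ} {z : ι → ℝ} (hz : ∀ i, z i = c) (hc : 0 ≤ c)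
    (hsum : 0 ≤ ∑ i, w i * z i * slack lam ρ n z i) : Admissible w lam ρ n z := by
  have key : ∀ i j, lam i ≤ lam j → slack lam ρ n z j ≤ slack lam ρ n z i := by
    intro i j hij
    simp only [slack, hz]
    nlinarith
  refine ⟨fun i => by rw [hz]; exact hc, fun i j hij hj => hj.trans (key i j hij),
    fun i j hij _ => ?_, hsum⟩
  rw [hz i, hz j]
  exact mul_le_mul_of_nonneg_right (key i j hij) hc

variable {w lam z z' : ι → ℝ} {η ρ n n' : ℝ}

lemma Admissible.norm_le (h : Admissible w lam ρ n z) (hw : ∀ i, 0 ≤ w i) (hη : 0 < η)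
    (hn' : 0 ≤ n')
    (hnorm : n ^ 2 = ∑ i, w i * z i ^ 2) (hnorm' : n' ^ 2 = ∑ i, w i * z' i ^ 2)
    (hstep : ∀ i, z' i = z i + η * slack lam ρ n z i) : n ≤ n' := by
  have : n ^ 2 ≤ n' ^ 2 := by
    have e : n' ^ 2 = n ^ 2 + 2 * η * ∑ i, w i * z i * slack lam ρ n z i
        + η ^ 2 * ∑ i, w i * slack lam ρ n z i ^ 2 := by
      rw [hnorm, hnorm', Finset.mul_sum, Finset.mul_sum, ← Finset.sum_add_distrib,
        ← Finset.sum_add_distrib]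
      exact Finset.sum_congr rfl fun i _ => by rw [hstep]; ring
    have h1 : 0 ≤ 2 * η * ∑ i, w i * z i * slack lam ρ n z i :=
      mul_nonneg (by positivity) h.sum_nonneg
    have h2 : 0 ≤ η ^ 2 * ∑ i, w i * slack lam ρ n z i ^ 2 :=
      mul_nonneg (by positivity) (Finset.sum_nonneg fun i _ => mul_nonneg (hw i) (sq_nonneg _))
    linarith
  exact le_of_sq_le_sq this hn'

/-- The new slack is `(1 - η (λ i + ρ n)) * g i - ρ (n' - n) * z' i`. Its first factor is positive
and decreasing in the eigenvalue, and the second term lowers every ratio to `z'` by the same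
constant, so the order of the ratios survives. The delicate point is the sign of the sum, where the
growth of the norm has to be paid for. -/
lemma Admissible.step (h : Admissible w lam ρ n z) (hw : ∀ i, 0 ≤ w i) (hη : 0 < η) (hρ : 0 < ρ)
    (hn : 0 ≤ n) (hn' : 0 ≤ n')
    (hnorm : n ^ 2 = ∑ i, w i * z i ^ 2) (hnorm' : n' ^ 2 = ∑ i, w i * z' i ^ 2)
    (hstep : ∀ i, z' i = z i + η * slack lam ρ n z i)
    (hη1 : ∀ i, η * (lam i + ρ * n + 2 * ρ * n') < 1) : Admissible w lam ρ n' z' := by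
  have hnn : n ≤ n' := h.norm_le hw hη hn' hnorm hnorm' hstep
  set g := slack lam ρ n z with hg
  have hc : ∀ i, 0 < 1 - η * (lam i + ρ * n) := fun i => by
    have : 0 ≤ η * (2 * ρ * n') := by positivity
    nlinarith [hη1 i]
  have hz' : ∀ i, z' i = (1 - η * (lam i + ρ * n)) * z i + η := fun i => by
    rw [hstep, hg]; simp only [slack]; ring
  have hz'pos : ∀ i, 0 < z' i := fun i => by
    rw [hz']; have := mul_nonneg (hc i).le (h.nonneg i); linarith
  have hg' : ∀ i, slack lam ρ n' z' i =
      (1 - η * (lam i + ρ * n)) * g i - ρ * (n' - n) * z' i := fun i => by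
    rw [slack, hstep, hg]; simp only [slack]; ring
  have hΔ : 0 ≤ ρ * (n' - n) := mul_nonneg hρ.le (sub_nonneg.2 hnn)
  have hback : ∀ j, 0 ≤ slack lam ρ n' z' j → 0 ≤ g j := fun j hj => by
    by_contra hc'
    have h1 := mul_neg_of_pos_of_neg (hc j) (not_le.1 hc')
    have h2 := mul_nonneg hΔ (hz'pos j).le
    rw [hg'] at hj
    linarith
  have hratio : ∀ i j, lam i ≤ lam j → 0 ≤ slack lam ρ n' z' j →
      (1 - η * (lam j + ρ * n)) * g j * z' i ≤ (1 - η * (lam i + ρ * n)) * g i * z' j := by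
    intro i j hij hj
    have hgj := hback j hj
    have hgi := h.slack_nonneg i j hij hgj
    have hr := h.ratio i j hij hgj
    have h1 : g j * z' i ≤ g i * z' j := by
      rw [hstep i, hstep j]
      nlinarith
    have h2 : 1 - η * (lam j + ρ * n) ≤ 1 - η * (lam i + ρ * n) := by nlinarith
    calc (1 - η * (lam j + ρ * n)) * g j * z' i
        = (1 - η * (lam j + ρ * n)) * (g j * z' i) := by ring
      _ ≤ (1 - η * (lam j + ρ * n)) * (g i * z' j) := mul_le_mul_of_nonneg_left h1 (hc j).le
      _ ≤ (1 - η * (lam i + ρ * n)) * (g i * z' j) :=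
          mul_le_mul_of_nonneg_right h2 (mul_nonneg hgi (hz'pos j).le)
      _ = _ := by ring
  refine ⟨fun i => (hz'pos i).le, fun i j hij hj => ?_, fun i j hij hj => ?_, ?_⟩
  · have h1 := hratio i j hij hj
    have h2 : ρ * (n' - n) * z' j ≤ (1 - η * (lam j + ρ * n)) * g j := by
      rw [hg'] at hj; linarith
    have h3 : ρ * (n' - n) * z' i * z' j ≤ (1 - η * (lam i + ρ * n)) * g i * z' j := by
      refine le_trans ?_ h1
      calc ρ * (n' - n) * z' i * z' j = (ρ * (n' - n) * z' j) * z' i := by ring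
        _ ≤ _ := mul_le_mul_of_nonneg_right h2 (hz'pos i).le
    rw [hg']
    have := le_of_mul_le_mul_right h3 (hz'pos j)
    linarith
  · have h1 := hratio i j hij hj
    rw [hg', hg']
    nlinarith
  · rcases isEmpty_or_nonempty ι with hι | hι
    · simp
    -- The factor `1 - η (λ i + ρ n)` decreases in the eigenvalue, so it may be frozen at the
    -- crossing index. The frozen factor is at least `2ηρn'`, which is enough to absorb `ρ (n' - n)
    -- n'²`.
    obtain ⟨k, hk⟩ := exists_crossing lam g h.slack_nonneg
    have hsplit : ∑ i, w i * z' i * slack lam ρ n' z' i =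
        (∑ i, w i * z' i * ((1 - η * (lam i + ρ * n)) * g i)) - ρ * (n' - n) * n' ^ 2 := by
      rw [hnorm', Finset.mul_sum, ← Finset.sum_sub_distrib]
      exact Finset.sum_congr rfl fun i _ => by rw [hg']; ring
    have hcross : (1 - η * (lam k + ρ * n)) * ∑ i, w i * z' i * g i ≤
        ∑ i, w i * z' i * ((1 - η * (lam i + ρ * n)) * g i) := by
      rw [Finset.mul_sum]
      refine Finset.sum_le_sum fun i _ => ?_
      have := mul_nonneg (mul_nonneg (mul_nonneg (hw i) (hz'pos i).le) hη.le) (hk i)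
      linarith
    have hdiff : n' ^ 2 - n ^ 2 = η * ∑ i, w i * (z i + z' i) * g i := by
      rw [hnorm, hnorm', ← Finset.sum_sub_distrib, Finset.mul_sum]
      exact Finset.sum_congr rfl fun i _ => by rw [hstep]; ring
    have hhalf : (n' ^ 2 - n ^ 2) ≤ 2 * η * ∑ i, w i * z' i * g i := by
      rw [hdiff, Finset.mul_sum, Finset.mul_sum]
      refine Finset.sum_le_sum fun i _ => ?_
      have := mul_nonneg (mul_nonneg (hw i) (sq_nonneg (η * g i))) zero_le_one
      rw [hstep i]
      linarith
    set B := ∑ i, w i * z' i * g i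
    have hB : 0 ≤ B := by
      have : 0 ≤ n' ^ 2 - n ^ 2 := by nlinarith
      have : 0 ≤ 2 * η * B := this.trans hhalf
      exact nonneg_of_mul_nonneg_right this (by positivity)
    have h1 : 2 * η * ρ * n' * B ≤ (1 - η * (lam k + ρ * n)) * B := by
      refine mul_le_mul_of_nonneg_right ?_ hB
      linarith [hη1 k]
    have h2 : ρ * (n' - n) * n' ^ 2 ≤ 2 * η * ρ * n' * B := by
      calc ρ * (n' - n) * n' ^ 2 ≤ ρ * n' * (n' ^ 2 - n ^ 2) := by
            have : 0 ≤ ρ * n' * ((n' - n) * n) :=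
              mul_nonneg (by positivity) (mul_nonneg (sub_nonneg.2 hnn) hn)
            linarith
        _ ≤ ρ * n' * (2 * η * B) := mul_le_mul_of_nonneg_left hhalf (by positivity)
        _ = _ := by ring
    rw [hsplit]
    linarith

/-- An admissible point is no longer than the minimizer for the shifted matrix. -/
lemma Admissible.sq_le (h : Admissible w lam ρ n z) (hw : ∀ i, 0 ≤ w i)
    (hnorm : n ^ 2 = ∑ i, w i * z i ^ 2) (hpos : ∀ i, 0 < lam i + ρ * n) :
    n ^ 2 ≤ ∑ i, w i / (lam i + ρ * n) ^ 2 := by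
  rcases isEmpty_or_nonempty ι with hι | hι
  · simp [hnorm]
  -- The same freezing argument, now with the decreasing weight `1 / (λ i + ρ n)`. The bound then
  -- follows by completing the square.
  obtain ⟨k, hk⟩ := exists_crossing lam (slack lam ρ n z) h.slack_nonneg
  have h1 : 0 ≤ ∑ i, w i * z i * slack lam ρ n z i / (lam i + ρ * n) := by
    have : (∑ i, w i * z i * slack lam ρ n z i) / (lam k + ρ * n) ≤
        ∑ i, w i * z i * slack lam ρ n z i / (lam i + ρ * n) := by
      rw [Finset.sum_div]
      refine Finset.sum_le_sum fun i _ => ?_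
      rw [div_le_div_iff₀ (hpos k) (hpos i)]
      have := mul_nonneg (mul_nonneg (hw i) (h.nonneg i)) (hk i)
      linarith
    exact (div_nonneg h.sum_nonneg (hpos k).le).trans this
  have h2 : n ^ 2 ≤ ∑ i, w i * z i / (lam i + ρ * n) := by
    have : ∑ i, w i * z i * slack lam ρ n z i / (lam i + ρ * n) =
        (∑ i, w i * z i / (lam i + ρ * n)) - n ^ 2 := by
      rw [hnorm, ← Finset.sum_sub_distrib]
      refine Finset.sum_congr rfl fun i _ => ?_
      have := (hpos i).ne'
      simp only [slack]
      field_simp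
    linarith
  have h3 : 2 * ∑ i, w i * z i / (lam i + ρ * n) ≤ n ^ 2 + ∑ i, w i / (lam i + ρ * n) ^ 2 := by
    rw [hnorm, Finset.mul_sum, ← Finset.sum_add_distrib]
    refine Finset.sum_le_sum fun i _ => ?_
    have e : w i * z i ^ 2 + w i / (lam i + ρ * n) ^ 2 - 2 * (w i * z i / (lam i + ρ * n)) =
        w i * (z i - 1 / (lam i + ρ * n)) ^ 2 := by
      have := (hpos i).ne'
      field_simp
      ring
    have := mul_nonneg (hw i) (sq_nonneg (z i - 1 / (lam i + ρ * n)))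
    linarith
  linarith

end SpectralDynamics

end CubicGD

/-! ### The cubic objective: expansions, second-order condition at the minimizer, radii. -/

namespace CubicGD

section Cubic

variable {d : ℕ} {A : Matrix (Fin d) (Fin d) ℝ} {b s : E d} {ρ : ℝ}

/-- The matrix `A` acting on Euclidean space. -/
noncomputable abbrev op (A : Matrix (Fin d) (Fin d) ℝ) : E d →L[ℝ] E d := Matrix.toEuclideanCLM (𝕜 := ℝ) A

/-- The gradient of the cubic objective. -/
noncomputable def grad (A : Matrix (Fin d) (Fin d) ℝ) (b : E d) (ρ : ℝ) (x : E d) : E d :=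
  op A x + b + (ρ * ‖x‖) • x

lemma inner_op_comm (hA : A.IsHermitian) (x y : E d) :
    inner ℝ (op A x) y = inner ℝ x (op A y) :=
  Matrix.isSymmetric_toEuclideanLin_iff.2 hA x y

lemma hasGradientAt_objective (hA : A.IsHermitian) (b : E d) (ρ : ℝ) (x : E d) :
    HasGradientAt (objective A b ρ) (grad A b ρ x) x := by
  have h1 : HasFDerivAt (fun x : E d => 1 / 2 * inner ℝ x (op A x))
      ((1 / 2 : ℝ) • ((fderivInnerCLM ℝ (x, op A x)).comp
        ((ContinuousLinearMap.id ℝ (E d)).prod (op A)))) x :=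
    ((hasFDerivAt_id x).inner ℝ (op A).hasFDerivAt).const_mul (1 / 2)
  have h2 : HasFDerivAt (fun x : E d => (inner ℝ b x : ℝ)) (innerSL ℝ b) x :=
    (innerSL ℝ b).hasFDerivAt
  have h3 : HasFDerivAt (fun x : E d => ρ / 3 * ‖x‖ ^ 3)
      ((ρ / 3) • ((3 * ‖x‖) • innerSL ℝ x)) x := by
    have := (hasFDerivAt_norm_rpow x (p := 3) (by norm_num)).const_mul (ρ / 3)
    norm_num at this
    exact_mod_cast this
  rw [hasGradientAt_iff_hasFDerivAt]
  refine ((h1.add h2).add h3).congr_fderiv ?_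
  ext v
  simp only [add_apply, smul_apply, smul_eq_mul,
    ContinuousLinearMap.comp_apply, ContinuousLinearMap.prod_apply, fderivInnerCLM_apply,
    innerSL_apply_apply, InnerProductSpace.toDual_apply_apply, grad, inner_add_left,
    real_inner_smul_left, ContinuousLinearMap.id_apply]
  rw [← inner_op_comm hA x v, real_inner_comm (op A x) v]
  ring

lemma gradient_objective (hA : A.IsHermitian) (b : E d) (ρ : ℝ) (x : E d) :
    gradient (objective A b ρ) x = grad A b ρ x :=
  (hasGradientAt_objective hA b ρ x).gradient

/-- The inner product of `x` and `u` is eliminated in favour of the three norms, so the expansion is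
exact. It serves both for the gap at the minimizer and for the descent inequality. -/
lemma objective_add (hA : A.IsHermitian) (b : E d) (ρ : ℝ) (x u : E d) :
    objective A b ρ (x + u) = objective A b ρ x + inner ℝ (grad A b ρ x) u +
      1 / 2 * inner ℝ u (op A u) +
      ρ * ((‖x + u‖ - ‖x‖) ^ 2 * (2 * ‖x + u‖ + ‖x‖) / 6 + ‖x‖ * ‖u‖ ^ 2 / 2) := by
  have h1 := norm_add_sq_real x u
  have h2 : inner ℝ u (op A x) = (inner ℝ x (op A u) : ℝ) := by
    rw [← inner_op_comm hA x u, real_inner_comm]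
  have h3 : (inner ℝ x u : ℝ) = (‖x + u‖ ^ 2 - ‖x‖ ^ 2 - ‖u‖ ^ 2) / 2 := by linarith
  simp only [objective, grad, map_add, inner_add_left, inner_add_right, real_inner_smul_left]
  rw [inner_op_comm hA x u, h2, h3]
  ring

lemma grad_eq_zero (hA : A.IsHermitian) (hs : IsMinOn (objective A b ρ) Set.univ s) :
    grad A b ρ s = 0 := by
  have h1 := (hasGradientAt_iff_hasFDerivAt.1 (hasGradientAt_objective hA b ρ s))
  have h2 := (hs.isLocalMin Filter.univ_mem).hasFDerivAt_eq_zero h1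
  simpa using h2

lemma abs_inner_op_le (x y : E d) : |inner ℝ x (op A y)| ≤ opNorm A * ‖x‖ * ‖y‖ := by
  calc |inner ℝ x (op A y)| ≤ ‖x‖ * ‖op A y‖ := abs_real_inner_le_norm _ _
    _ ≤ ‖x‖ * (opNorm A * ‖y‖) :=
        mul_le_mul_of_nonneg_left ((op A).le_opNorm y) (norm_nonneg _)
    _ = _ := by ring

lemma opNorm_nonneg : 0 ≤ opNorm A := norm_nonneg _

/-- The gap to the minimal value. -/
lemma objective_eq_of_isMinOn (hA : A.IsHermitian) (hs : IsMinOn (objective A b ρ) Set.univ s)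
    (u : E d) :
    objective A b ρ (s + u) = objective A b ρ s +
      1 / 2 * (inner ℝ u (op A u) + ρ * ‖s‖ * ‖u‖ ^ 2) +
      ρ / 6 * ((‖s‖ - ‖s + u‖) ^ 2 * (‖s‖ + 2 * ‖s + u‖)) := by
  rw [objective_add hA, grad_eq_zero hA hs, inner_zero_left]
  ring

/-! ### Eigenvectors -/

lemma op_eigenvector (hA : A.IsHermitian) (i : Fin d) :
    op A (hA.eigenvectorBasis i) = hA.eigenvalues i • hA.eigenvectorBasis i := by
  ext j
  have := congrFun (hA.mulVec_eigenvectorBasis i) j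
  simpa [Matrix.ofLp_toEuclideanCLM] using this

lemma inner_eigenvector_op (hA : A.IsHermitian) (i : Fin d) (x : E d) :
    inner ℝ (hA.eigenvectorBasis i) (op A x) =
      hA.eigenvalues i * inner ℝ (hA.eigenvectorBasis i) x := by
  rw [← inner_op_comm hA, op_eigenvector, real_inner_smul_left]

lemma sum_sq_inner_eigenvector (hA : A.IsHermitian) (x : E d) :
    ∑ i, (inner ℝ (hA.eigenvectorBasis i) x : ℝ) ^ 2 = ‖x‖ ^ 2 := by
  simpa using hA.eigenvectorBasis.sum_sq_norm_inner_right x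

lemma inner_op_eq_sum (hA : A.IsHermitian) (x : E d) :
    inner ℝ x (op A x) =
      ∑ i, hA.eigenvalues i * (inner ℝ (hA.eigenvectorBasis i) x : ℝ) ^ 2 := by
  rw [← hA.eigenvectorBasis.sum_inner_mul_inner x (op A x)]
  refine Finset.sum_congr rfl fun i _ => ?_
  rw [inner_eigenvector_op, real_inner_comm]
  ring

lemma abs_eigenvalue_le (hA : A.IsHermitian) (i : Fin d) : |hA.eigenvalues i| ≤ opNorm A := by
  have h := abs_inner_op_le (A := A) (hA.eigenvectorBasis i) (hA.eigenvectorBasis i)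
  rw [inner_eigenvector_op] at h
  simpa using h

lemma neg_gam_le_eigenvalue (hA : A.IsHermitian) (i : Fin d) :
    -gam A hA ≤ hA.eigenvalues i := by
  rw [gam, neg_neg]
  exact ciInf_le (Set.finite_range _).bddBelow i

lemma exists_eigenvalue_eq (hA : A.IsHermitian) (hd : 0 < d) :
    ∃ i, hA.eigenvalues i = -gam A hA := by
  have : Nonempty (Fin d) := ⟨⟨0, hd⟩⟩
  obtain ⟨i, hi⟩ := exists_eq_ciInf_of_finite (f := hA.eigenvalues)
  exact ⟨i, by rw [gam, neg_neg, hi]⟩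

lemma neg_gam_mul_le_inner (hA : A.IsHermitian) (x : E d) :
    -gam A hA * ‖x‖ ^ 2 ≤ inner ℝ x (op A x) := by
  rw [inner_op_eq_sum hA, ← sum_sq_inner_eigenvector hA, Finset.mul_sum]
  exact Finset.sum_le_sum fun i _ =>
    mul_le_mul_of_nonneg_right (neg_gam_le_eigenvalue hA i) (sq_nonneg _)

/-- At a nonzero global minimizer, `A + ρ‖s‖` is positive semidefinite. -/
lemma eigenvalue_add_nonneg (hA : A.IsHermitian) (hρ : 0 < ρ)
    (hs : IsMinOn (objective A b ρ) Set.univ s) (hs0 : s ≠ 0) (i : Fin d) :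
    0 ≤ hA.eigenvalues i + ρ * ‖s‖ := by
  set v := hA.eigenvectorBasis i with hv
  have hv1 : ‖v‖ = 1 := hA.eigenvectorBasis.orthonormal.1 i
  have hS : 0 < ‖s‖ := norm_pos_iff.2 hs0
  have key : ∀ τ : ℝ, 0 ≤ 1 / 2 * ((hA.eigenvalues i + ρ * ‖s‖) * τ ^ 2) +
      ρ / 6 * ((‖s‖ - ‖s + τ • v‖) ^ 2 * (‖s‖ + 2 * ‖s + τ • v‖)) := fun τ => by
    have h1 := hs (Set.mem_univ (s + τ • v))
    simp only [Set.mem_ofPred_eq] at h1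
    rw [objective_eq_of_isMinOn hA hs] at h1
    have h2 : inner ℝ (τ • v) (op A (τ • v)) = hA.eigenvalues i * τ ^ 2 := by
      rw [map_smul, hv, op_eigenvector, real_inner_smul_left, real_inner_smul_right,
        real_inner_smul_right, real_inner_self_eq_norm_sq, ← hv, hv1]
      ring
    rw [h2, norm_smul, hv1, Real.norm_eq_abs, mul_one, sq_abs] at h1
    linarith
  have hnorm : ∀ τ : ℝ, ‖s + τ • v‖ ^ 2 = ‖s‖ ^ 2 + 2 * τ * inner ℝ s v + τ ^ 2 := fun τ => by
    rw [norm_add_sq_real, real_inner_smul_right, norm_smul, hv1, Real.norm_eq_abs, mul_one, sq_abs]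
    ring
  by_cases h0 : (inner ℝ s v : ℝ) = 0
  -- Orthogonal case: the norm changes only to second order in `τ`, so the cubic remainder is of
  -- order `τ⁴` and cannot offset a negative quadratic term once `τ` is small.
  · by_contra hneg
    push Not at hneg
    set a := hA.eigenvalues i + ρ * ‖s‖
    obtain ⟨τ, hτ, hτ2⟩ : ∃ τ : ℝ, 0 < τ ^ 2 ∧ τ ^ 2 * ρ < -a * ‖s‖ := by
      have hp : 0 < -a * ‖s‖ / (2 * ρ) := div_pos (mul_pos (neg_pos.2 hneg) hS) (by positivity)
      refine ⟨√(-a * ‖s‖ / (2 * ρ)), ?_, ?_⟩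
      · rw [Real.sq_sqrt hp.le]; exact hp
      · rw [Real.sq_sqrt hp.le]
        have : -a * ‖s‖ / (2 * ρ) * ρ = -a * ‖s‖ / 2 := by field_simp
        rw [this]
        have := mul_pos (neg_pos.2 hneg) hS
        linarith
    have h1 := key τ
    have h2 := hnorm τ
    rw [h0] at h2
    set m := ‖s + τ • v‖ with hm
    have hm0 : 0 ≤ m := norm_nonneg _
    have h3 : (m - ‖s‖) * (m + ‖s‖) = τ ^ 2 := by linarith
    have h4 : (‖s‖ - m) ^ 2 * (‖s‖ + 2 * m) * ‖s‖ ≤ 2 * (τ ^ 2) ^ 2 := by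
      rw [← h3]
      have : 0 ≤ (‖s‖ - m) ^ 2 * (‖s‖ ^ 2 + 2 * m * ‖s‖ + 2 * m ^ 2) := by positivity
      linarith
    have h5 : 0 ≤ (1 / 2 * (a * τ ^ 2) + ρ / 6 * ((‖s‖ - m) ^ 2 * (‖s‖ + 2 * m))) * ‖s‖ :=
      mul_nonneg h1 hS.le
    have h6 : ρ / 6 * ((‖s‖ - m) ^ 2 * (‖s‖ + 2 * m) * ‖s‖) ≤ ρ / 6 * (2 * (τ ^ 2) ^ 2) :=
      mul_le_mul_of_nonneg_left h4 (by positivity)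
    have h7 : τ ^ 2 * (τ ^ 2 * ρ) < τ ^ 2 * (-a * ‖s‖) := mul_lt_mul_of_pos_left hτ2 hτ
    nlinarith
  -- Otherwise reflect `s` in the hyperplane orthogonal to `v`. The norm is unchanged, so only the
  -- quadratic term remains.
  · have h1 := key (-2 * inner ℝ s v)
    have h2 : ‖s + (-2 * inner ℝ s v) • v‖ = ‖s‖ := by
      have := hnorm (-2 * inner ℝ s v)
      have : ‖s + (-2 * inner ℝ s v) • v‖ ^ 2 = ‖s‖ ^ 2 := by linarith
      exact (sq_eq_sq₀ (norm_nonneg _) (norm_nonneg _)).1 this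
    rw [h2] at h1
    have h3 : 0 < (inner ℝ s v : ℝ) ^ 2 := by positivity
    by_contra hneg
    push Not at hneg
    nlinarith [mul_pos (neg_pos.2 hneg) h3]

lemma gam_le (hA : A.IsHermitian) (hd : 0 < d) (hρ : 0 < ρ)
    (hs : IsMinOn (objective A b ρ) Set.univ s) (hs0 : s ≠ 0) : gam A hA ≤ ρ * ‖s‖ := by
  obtain ⟨i, hi⟩ := exists_eigenvalue_eq hA hd
  have := eigenvalue_add_nonneg hA hρ hs hs0 i
  linarith

/-! ### The radius -/

lemma radius_nonneg (hρ : 0 < ρ) : 0 ≤ radius A b ρ := by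
  have := opNorm_nonneg (A := A)
  unfold radius; positivity

lemma radius_sq (hρ : 0 < ρ) :
    ρ * radius A b ρ ^ 2 = opNorm A * radius A b ρ + ‖b‖ := by
  have h : 0 ≤ (opNorm A / (2 * ρ)) ^ 2 + ‖b‖ / ρ := by positivity
  have h2 := Real.sq_sqrt h
  unfold radius
  set c := √((opNorm A / (2 * ρ)) ^ 2 + ‖b‖ / ρ)
  have e1 : ρ * (opNorm A / (2 * ρ)) = opNorm A / 2 := by field_simp
  have e2 : ρ * (‖b‖ / ρ) = ‖b‖ := by field_simp
  have e3 : ρ * c ^ 2 = opNorm A / 2 * (opNorm A / (2 * ρ)) + ‖b‖ := by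
    rw [h2, mul_add, e2, ← e1]; ring
  set p := opNorm A / (2 * ρ)
  linear_combination e3 + (p + 2 * c) * e1

lemma opNorm_le_radius (hρ : 0 < ρ) : opNorm A ≤ ρ * radius A b ρ := by
  have h : opNorm A / (2 * ρ) ≤ √((opNorm A / (2 * ρ)) ^ 2 + ‖b‖ / ρ) :=
    Real.le_sqrt_of_sq_le (le_add_of_nonneg_right (by positivity))
  have e1 : ρ * (opNorm A / (2 * ρ)) = opNorm A / 2 := by field_simp
  have := mul_le_mul_of_nonneg_left h hρ.le
  unfold radius
  linarith

lemma norm_b_le (hA : A.IsHermitian) (hρ : 0 < ρ) (hs : IsMinOn (objective A b ρ) Set.univ s) :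
    ‖b‖ ≤ (opNorm A + ρ * ‖s‖) * ‖s‖ ∧ ρ * ‖s‖ ^ 2 ≤ opNorm A * ‖s‖ + ‖b‖ := by
  have h := grad_eq_zero hA hs
  have h1 : ‖op A s‖ ≤ opNorm A * ‖s‖ := (op A).le_opNorm s
  have h2 : ‖(ρ * ‖s‖) • s‖ = ρ * ‖s‖ * ‖s‖ := by
    rw [norm_smul, Real.norm_of_nonneg (by positivity)]
  constructor
  · have e : b = -(op A s + (ρ * ‖s‖) • s) := by
      rw [eq_neg_iff_add_eq_zero, ← h, grad]; abel
    rw [e, norm_neg]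
    refine (norm_add_le _ _).trans ?_
    rw [h2]; linarith
  · have e : (ρ * ‖s‖) • s = -(op A s + b) := by
      rw [eq_neg_iff_add_eq_zero, ← h, grad]; abel
    have : ‖(ρ * ‖s‖) • s‖ ≤ ‖op A s‖ + ‖b‖ := by
      rw [e, norm_neg]; exact norm_add_le _ _
    rw [h2] at this
    linarith

lemma norm_le_radius (hA : A.IsHermitian) (hρ : 0 < ρ)
    (hs : IsMinOn (objective A b ρ) Set.univ s) : ‖s‖ ≤ radius A b ρ := by
  have h1 := (norm_b_le hA hρ hs).2
  have h2 := radius_sq (A := A) (b := b) hρ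
  have h3 := opNorm_le_radius (A := A) (b := b) hρ
  by_contra hc
  push Not at hc
  have h4 := radius_nonneg (A := A) (b := b) hρ
  have h5 : 0 ≤ (‖s‖ - radius A b ρ) * (ρ * radius A b ρ - opNorm A) :=
    mul_nonneg (by linarith) (by linarith)
  have h6 : 0 < ρ * ‖s‖ * (‖s‖ - radius A b ρ) :=
    mul_pos (mul_pos hρ (by linarith)) (by linarith)
  nlinarith

/-- Together with `norm_le_radius` this makes `1/η` comparable to `L_s`, although `η` is defined
without reference to `s`. -/
lemma radius_le (hA : A.IsHermitian) (hρ : 0 < ρ)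
    (hs : IsMinOn (objective A b ρ) Set.univ s) :
    ρ * radius A b ρ ≤ opNorm A + ρ * ‖s‖ := by
  have h1 := (norm_b_le hA hρ hs).1
  have h2 := radius_sq (A := A) (b := b) hρ
  have h3 := opNorm_nonneg (A := A)
  have hS := norm_nonneg s
  by_contra hc
  push Not at hc
  set R := radius A b ρ
  have hRS : ‖s‖ < R := by
    by_contra h
    nlinarith [mul_le_mul_of_nonneg_left (not_lt.1 h) hρ.le]
  have h4 : 0 < (ρ * R - (opNorm A + ρ * ‖s‖)) * R :=
    mul_pos (by linarith) (by linarith)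
  have h5 : 0 ≤ ρ * ‖s‖ * (R - ‖s‖) := mul_nonneg (by positivity) (by linarith)
  have h6 : 0 ≤ (ρ * R - (opNorm A + ρ * ‖s‖)) * ‖s‖ := mul_nonneg (by linarith) hS
  have h7 : 0 < (ρ * R - (opNorm A + ρ * ‖s‖)) * (R - ‖s‖) := mul_pos (by linarith) (by linarith)
  nlinarith [mul_nonneg h3 (sub_nonneg.2 hRS.le)]

end Cubic

end CubicGD

/-! ### Anti-concentration of the uniform distribution on the sphere. -/

namespace CubicGD

section SmallBall

open Metric
open scoped Pointwise

variable {d : ℕ}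

lemma volume_ball_le_three (hd : 0 < d) {h : ℝ} (h0 : 0 ≤ h) (h1 : h * d ≤ 1) :
    (volume : Measure (E d)).real (ball 0 (1 + h)) ≤
      3 * (volume : Measure (E d)).real (ball 0 1) := by
  have : Nonempty (Fin d) := ⟨⟨0, hd⟩⟩
  have e : (volume : Measure (E d)).real (ball 0 (1 + h)) =
      (1 + h) ^ d * (volume : Measure (E d)).real (ball 0 1) := by
    rw [measureReal_def, Measure.addHaar_ball volume _ (by linarith), ENNReal.toReal_mul,
      ENNReal.toReal_ofReal (by positivity), finrank_euclideanSpace_fin, measureReal_def]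
  rw [e]
  refine mul_le_mul_of_nonneg_right ?_ measureReal_nonneg
  calc (1 + h) ^ d ≤ Real.exp h ^ d :=
        pow_le_pow_left₀ (by linarith) (by linarith [Real.add_one_le_exp h]) _
    _ = Real.exp (h * d) := by rw [← Real.exp_nat_mul, mul_comm]
    _ ≤ Real.exp 1 := Real.exp_le_exp.2 h1
    _ ≤ 3 := by linarith [Real.exp_one_lt_d9]

/-- Disjoint translates: a set in the unit ball that no line in the direction `e` meets in two
points more than `κ` apart has small volume. -/
lemma volume_thin_le (hd : 0 < d) {K : Set (E d)} (hK : MeasurableSet K) (hKb : K ⊆ ball 0 1)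
    {e : E d} (he : ‖e‖ = 1) {κ : ℝ} (hκ : 0 < κ)
    (hthin : ∀ x ∈ K, ∀ t : ℝ, 0 ≤ t → x + t • e ∈ K → t ≤ κ) :
    (volume : Measure (E d)).real K ≤ 12 * κ * d * (volume : Measure (E d)).real (ball 0 1) := by
  have hdR : (0 : ℝ) < d := Nat.cast_pos.2 hd
  set V := (volume : Measure (E d)).real (ball 0 1)
  have hV : 0 ≤ V := measureReal_nonneg
  rcases lt_or_ge 1 (2 * κ * d) with hlarge | hsmall
  · calc (volume : Measure (E d)).real K ≤ V := measureReal_mono hKb measure_ball_lt_top.ne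
      _ ≤ 12 * κ * d * V := le_mul_of_one_le_left hV (by linarith)
  -- Translates of `K` by multiples of `2κ` along `e` are disjoint. With this many of them, all stay
  -- in the ball of radius `1 + 1/d`, whose volume is at most `3` times that of the unit ball.
  set N := ⌊1 / (2 * κ * d)⌋₊ with hN
  have hpos : 0 < 2 * κ * d := by positivity
  have h1 : 1 ≤ 1 / (2 * κ * d) := by rw [le_div_iff₀ hpos]; linarith
  have hN1 : 1 ≤ N := Nat.le_floor (by simpa using h1)
  have hNle : (N : ℝ) ≤ 1 / (2 * κ * d) := Nat.floor_le (by positivity)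
  have hNge : 1 / (2 * κ * d) ≤ 2 * N := by
    have := Nat.lt_floor_add_one (1 / (2 * κ * d))
    have h2 : (1 : ℝ) ≤ N := by exact_mod_cast hN1
    rw [← hN] at this
    linarith
  have hN2 : 2 * κ * N * d ≤ 1 := by
    rw [le_div_iff₀ hpos] at hNle; linarith
  have hN3 : 1 ≤ 4 * κ * d * N := by
    rw [div_le_iff₀ hpos] at hNge; linarith
  let f : ℕ → Set (E d) := fun j => (fun x => x + (-((2 * κ * j) • e))) ⁻¹' K
  have hfm : ∀ j, MeasurableSet (f j) := fun j => (measurable_add_const _) hK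
  have hfv : ∀ j, (volume : Measure (E d)).real (f j) = (volume : Measure (E d)).real K := fun j => by
    rw [measureReal_def, measureReal_def, measure_preimage_add_right]
  have hlt : ∀ i j : ℕ, i < j → ∀ x, x ∈ f i → x ∈ f j → False := fun i j hij x hi hj => by
    have h3 : (1 : ℝ) ≤ (j : ℝ) - i := by
      have : (i : ℝ) + 1 ≤ j := by exact_mod_cast hij
      linarith
    have h2 := hthin _ hj (2 * κ * (j - i)) (by nlinarith) (by
      have : x + (-((2 * κ * j) • e)) + (2 * κ * ((j : ℝ) - i)) • e =
        x + (-((2 * κ * i) • e)) := by module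
      rw [this]; exact hi)
    nlinarith
  have hdisj : Set.PairwiseDisjoint (↑(Finset.range N)) f := fun i _ j _ hij => by
    refine Set.disjoint_left.2 fun x hi hj => ?_
    rcases lt_or_gt_of_ne hij with h | h
    · exact hlt i j h x hi hj
    · exact hlt j i h x hj hi
  have hsub : (⋃ j ∈ Finset.range N, f j) ⊆ ball 0 (1 + 2 * κ * N) := by
    intro x hx
    simp only [Set.mem_iUnion, Finset.mem_range] at hx
    obtain ⟨j, hj, hx⟩ := hx
    have h2 := hKb hx
    rw [mem_ball_zero_iff] at h2 ⊢
    have e1 : x = (x + (-((2 * κ * j) • e))) + (2 * κ * j) • e := by module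
    have h3 : ‖(2 * κ * j) • e‖ = 2 * κ * j := by
      rw [norm_smul, he, Real.norm_of_nonneg (by positivity), mul_one]
    have h4 : (j : ℝ) ≤ N := by exact_mod_cast hj.le
    rw [e1]
    have h5 := norm_add_le (x + (-((2 * κ * j) • e))) ((2 * κ * j) • e)
    rw [h3] at h5
    nlinarith
  have hsum : (N : ℝ) * (volume : Measure (E d)).real K ≤ 3 * V := by
    calc (N : ℝ) * (volume : Measure (E d)).real K
        = (volume : Measure (E d)).real (⋃ j ∈ Finset.range N, f j) := by
          have hfin : ∀ j ∈ Finset.range N, volume (f j) ≠ ⊤ := fun j _ => by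
            have : volume (f j) = volume K := measure_preimage_add_right _ _ _
            rw [this]
            exact ((measure_mono hKb).trans_lt measure_ball_lt_top).ne
          rw [measureReal_biUnion_finset hdisj (fun j _ => hfm j) hfin]
          simp [hfv]
      _ ≤ (volume : Measure (E d)).real (ball 0 (1 + 2 * κ * N)) :=
          measureReal_mono hsub measure_ball_lt_top.ne
      _ ≤ 3 * V := volume_ball_le_three hd (by positivity) hN2
  have hvol : 0 ≤ (volume : Measure (E d)).real K := measureReal_nonneg
  calc (volume : Measure (E d)).real K ≤ 4 * κ * d * N * (volume : Measure (E d)).real K :=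
        le_mul_of_one_le_left hvol hN3
    _ = 4 * κ * d * (N * (volume : Measure (E d)).real K) := by ring
    _ ≤ 4 * κ * d * (3 * V) := mul_le_mul_of_nonneg_left hsum (by positivity)
    _ = _ := by ring

/-- The part of the unit ball over the band `|⟨v, q⟩ - a| ≤ τ` of the sphere. -/
def bandCone (v : E d) (a τ : ℝ) : Set (E d) :=
  {x | x ∈ ball (0 : E d) 1 ∧ |inner ℝ v x - a * ‖x‖| ≤ τ * ‖x‖}

lemma measurableSet_bandCone (v : E d) (a τ : ℝ) : MeasurableSet (bandCone v a τ) := by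
  have h : IsClosed {x : E d | |inner ℝ v x - a * ‖x‖| ≤ τ * ‖x‖} :=
    isClosed_le (by fun_prop) (by fun_prop)
  exact measurableSet_ball.inter h.measurableSet

/-- Multiplying by the conjugate factor removes the norm in favour of a quadratic form, whose change
along a line is explicit. -/
lemma abs_quadratic_le {v x : E d} {a τ : ℝ} (hv : ‖v‖ = 1) (ha : |a| ≤ 2) (hτ : 0 ≤ τ)
    (hx : x ∈ bandCone v a τ) : |inner ℝ v x ^ 2 - a ^ 2 * ‖x‖ ^ 2| ≤ 3 * τ := by
  obtain ⟨hb, hx⟩ := hx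
  rw [mem_ball_zero_iff] at hb
  have h0 := norm_nonneg x
  have h1 : |inner ℝ v x| ≤ ‖x‖ := by
    simpa [hv] using abs_real_inner_le_norm v x
  have h2 : |inner ℝ v x + a * ‖x‖| ≤ 3 := by
    calc |inner ℝ v x + a * ‖x‖| ≤ |inner ℝ v x| + |a * ‖x‖| := abs_add_le _ _
      _ = |inner ℝ v x| + |a| * ‖x‖ := by rw [abs_mul, abs_of_nonneg h0]
      _ ≤ 3 := by nlinarith
  have h3 : τ * ‖x‖ ≤ τ := mul_le_of_le_one_right hτ hb.le
  calc |inner ℝ v x ^ 2 - a ^ 2 * ‖x‖ ^ 2|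
      = |inner ℝ v x - a * ‖x‖| * |inner ℝ v x + a * ‖x‖| := by rw [← abs_mul]; ring_nf
    _ ≤ τ * 3 := mul_le_mul (hx.trans h3) h2 (abs_nonneg _) hτ
    _ = _ := by ring

/-- From `x` to `x + t e` the form `⟨v, x⟩² - a²‖x‖²` changes by `1 - a²` or by `-a²` times `2t⟨x,
e⟩ + t²`. In either alternative the coefficient has size at least `1/2`, and on the half-space the
other factor is at least `t²`. The form varies by at most `6τ`, so `t² ≤ 12τ`. -/
lemma volume_bandCone_half_le (hd : 0 < d) {v e : E d} {a τ : ℝ} (hv : ‖v‖ = 1) (he : ‖e‖ = 1)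
    (ha : |a| ≤ 2) (hτ : 0 < τ)
    (h : (a ^ 2 ≤ 1 / 2 ∧ inner ℝ v e ^ 2 = (1 : ℝ) ∧ ∀ x, inner ℝ v x * inner ℝ v e =
      (inner ℝ x e : ℝ)) ∨ (1 / 2 ≤ a ^ 2 ∧ inner ℝ v e = (0 : ℝ))) :
    (volume : Measure (E d)).real (bandCone v a τ ∩ {x | 0 ≤ inner ℝ x e}) ≤
      12 * √(12 * τ) * d * (volume : Measure (E d)).real (ball 0 1) := by
  refine volume_thin_le hd
    ((measurableSet_bandCone v a τ).inter (isClosed_le (by fun_prop) (by fun_prop)).measurableSet)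
    (fun x hx => hx.1.1) he (Real.sqrt_pos.2 (by positivity)) fun x hx t ht hxt => ?_
  have h1 := abs_le.1 (abs_quadratic_le hv ha hτ.le hx.1)
  have h2 := abs_le.1 (abs_quadratic_le hv ha hτ.le hxt.1)
  have hxe : 0 ≤ (inner ℝ x e : ℝ) := hx.2
  have h3 : ‖x + t • e‖ ^ 2 = ‖x‖ ^ 2 + 2 * t * inner ℝ x e + t ^ 2 := by
    rw [norm_add_sq_real, real_inner_smul_right, norm_smul, he, Real.norm_eq_abs, mul_one, sq_abs]
    ring
  have h4 : (inner ℝ v (x + t • e) : ℝ) = inner ℝ v x + t * inner ℝ v e := by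
    rw [inner_add_right, real_inner_smul_right]
  rw [h3, h4] at h2
  have h5 : 0 ≤ t * inner ℝ x e := mul_nonneg ht hxe
  refine Real.le_sqrt_of_sq_le ?_
  rcases h with ⟨ha2, h6, h7⟩ | ⟨ha2, h6⟩
  · have h8 : (inner ℝ v x + t * inner ℝ v e) ^ 2 = (inner ℝ v x : ℝ) ^ 2 + 2 * (t * inner ℝ x e)
        + t ^ 2 := by rw [← h7 x]; linear_combination t ^ 2 * h6
    rw [h8] at h2
    have h9 : 0 ≤ (1 / 2 - a ^ 2) * (2 * (t * inner ℝ x e) + t ^ 2) :=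
      mul_nonneg (by linarith) (by positivity)
    linarith
  · rw [h6] at h2
    have h9 : 0 ≤ (a ^ 2 - 1 / 2) * (2 * (t * inner ℝ x e) + t ^ 2) :=
      mul_nonneg (by linarith) (by positivity)
    linarith

lemma volume_bandCone_le (hd : 0 < d) {v u : E d} {a τ : ℝ} (hv : ‖v‖ = 1) (hu : ‖u‖ = 1)
    (hvu : (inner ℝ v u : ℝ) = 0) (ha : |a| ≤ 2) (hτ : 0 < τ) :
    (volume : Measure (E d)).real (bandCone v a τ) ≤
      24 * √(12 * τ) * d * (volume : Measure (E d)).real (ball 0 1) := by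
  obtain ⟨e, he, h1, h2⟩ : ∃ e : E d, ‖e‖ = 1 ∧
      ((a ^ 2 ≤ 1 / 2 ∧ inner ℝ v e ^ 2 = (1 : ℝ) ∧ ∀ x, inner ℝ v x * inner ℝ v e =
        (inner ℝ x e : ℝ)) ∨ (1 / 2 ≤ a ^ 2 ∧ inner ℝ v e = (0 : ℝ))) ∧
      ((a ^ 2 ≤ 1 / 2 ∧ inner ℝ v (-e) ^ 2 = (1 : ℝ) ∧ ∀ x, inner ℝ v x * inner ℝ v (-e) =
        (inner ℝ x (-e) : ℝ)) ∨ (1 / 2 ≤ a ^ 2 ∧ inner ℝ v (-e) = (0 : ℝ))) := by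
    have hvv : (inner ℝ v v : ℝ) = 1 := by rw [real_inner_self_eq_norm_sq, hv]; norm_num
    -- Near the equator move along `v`, near the poles along the orthogonal `u`. The existence of
    -- such a `u` is where dimension at least two enters.
    rcases le_total (a ^ 2) (1 / 2) with h | h
    · exact ⟨v, hv, Or.inl ⟨h, by rw [hvv]; norm_num, fun x => by
        rw [hvv, mul_one, real_inner_comm]⟩, Or.inl ⟨h, by rw [inner_neg_right, hvv]; norm_num,
        fun x => by rw [inner_neg_right, inner_neg_right, hvv, real_inner_comm]; ring⟩⟩
    · exact ⟨u, hu, Or.inr ⟨h, hvu⟩, Or.inr ⟨h, by rw [inner_neg_right, hvu, neg_zero]⟩⟩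
  have h3 := volume_bandCone_half_le hd hv he ha hτ h1
  have h4 := volume_bandCone_half_le hd hv (by rwa [norm_neg]) ha hτ h2
  have hsub : bandCone v a τ ⊆ (bandCone v a τ ∩ {x | 0 ≤ inner ℝ x e}) ∪
      (bandCone v a τ ∩ {x | 0 ≤ inner ℝ x (-e)}) := fun x hx => by
    rcases le_total 0 (inner ℝ x e : ℝ) with h | h
    · exact Or.inl ⟨hx, h⟩
    · refine Or.inr ⟨hx, ?_⟩
      change 0 ≤ (inner ℝ x (-e) : ℝ)
      rw [inner_neg_right]; linarith
  have hfin : volume ((bandCone v a τ ∩ {x | 0 ≤ inner ℝ x e}) ∪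
      (bandCone v a τ ∩ {x | 0 ≤ inner ℝ x (-e)})) ≠ ⊤ := by
    refine ((measure_mono ?_).trans_lt (measure_ball_lt_top (x := (0 : E d)) (r := 1))).ne
    rintro x (hx | hx) <;> exact hx.1.1
  have h5 := (measureReal_mono hsub hfin).trans (measureReal_union_le _ _)
  linarith

/-- The uniform distribution on the sphere gives little mass to thin bands. -/
lemma uniformSphere_band_le (hd : 0 < d) {v u : E d} {a τ : ℝ} (hv : ‖v‖ = 1) (hu : ‖u‖ = 1)
    (hvu : (inner ℝ v u : ℝ) = 0) (ha : |a| ≤ 2) (hτ : 0 < τ) :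
    (uniformSphere d).real {q | |inner ℝ v (q : E d) - a| ≤ τ} ≤ 24 * √(12 * τ) * d := by
  have : Nonempty (Fin d) := ⟨⟨0, hd⟩⟩
  have hS : MeasurableSet {q : sphere (0 : E d) 1 | |inner ℝ v (q : E d) - a| ≤ τ} :=
    (isClosed_le (by fun_prop) (by fun_prop)).measurableSet
  have hsub : Set.Ioo (0 : ℝ) 1 • ((↑) '' {q : sphere (0 : E d) 1 |
      |inner ℝ v (q : E d) - a| ≤ τ}) ⊆ bandCone v a τ := by
    rintro _ ⟨t, ht, _, ⟨q, hq, rfl⟩, rfl⟩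
    have hq1 : ‖(q : E d)‖ = 1 := norm_eq_of_mem_sphere q
    have hn : ‖t • (q : E d)‖ = t := by
      rw [norm_smul, hq1, Real.norm_of_nonneg ht.1.le, mul_one]
    refine ⟨by rw [mem_ball_zero_iff]; change ‖t • (q : E d)‖ < 1; rw [hn]; exact ht.2, ?_⟩
    change |inner ℝ v (t • (q : E d)) - a * ‖t • (q : E d)‖| ≤ τ * ‖t • (q : E d)‖
    rw [hn, real_inner_smul_right]
    have e : t * inner ℝ v (q : E d) - a * t = t * (inner ℝ v (q : E d) - a) := by ring
    rw [e, abs_mul, abs_of_nonneg ht.1.le, mul_comm τ]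
    exact mul_le_mul_of_nonneg_left hq ht.1.le
  have hV : 0 < (volume : Measure (E d)).real (ball 0 1) :=
    ENNReal.toReal_pos (measure_ball_pos _ _ one_pos).ne' measure_ball_lt_top.ne
  have h1 : (volume : Measure (E d)).toSphere.real
      {q | |inner ℝ v (q : E d) - a| ≤ τ} ≤ d * (volume : Measure (E d)).real (bandCone v a τ) := by
    rw [measureReal_def, Measure.toSphere_apply' _ hS, ENNReal.toReal_mul,
      finrank_euclideanSpace_fin, ENNReal.toReal_natCast]
    refine mul_le_mul_of_nonneg_left (measureReal_mono hsub ?_) (Nat.cast_nonneg d)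
    exact ((measure_mono fun x hx => hx.1).trans_lt (measure_ball_lt_top (x := (0 : E d)))).ne
  have h2 := volume_bandCone_le hd hv hu hvu ha hτ
  have hdR : (0 : ℝ) < d := Nat.cast_pos.2 hd
  rw [uniformSphere, measureReal_ennreal_smul_apply, ENNReal.toReal_inv, ← measureReal_def,
    Measure.toSphere_real_apply_univ, finrank_euclideanSpace_fin, inv_mul_le_iff₀ (by positivity)]
  calc _ ≤ _ := h1
    _ ≤ d * _ := mul_le_mul_of_nonneg_left h2 hdR.le
    _ = _ := by ring

end SmallBall

end CubicGD

/-! ### The perturbed iterates: invariants, growth, descent and the potential. -/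

namespace CubicGD

section Trajectory

variable {d : ℕ}

/-- Gradient descent on the objective with linear term `b + σ q`, compared with a nonzero global
minimizer `s` of the objective with linear term `b`. -/
structure PerturbedDescent (A : Matrix (Fin d) (Fin d) ℝ) (b : E d) (ρ : ℝ) (s : E d) (σ : ℝ)
    (q bt : E d) (r : ℝ) : Prop where
  hA : A.IsHermitian
  rho_pos : 0 < ρ
  isMinOn : IsMinOn (objective A b ρ) Set.univ s
  ne_zero : s ≠ 0
  sigma_nonneg : 0 ≤ σ
  sigma_le : 12 * σ ≤ ρ * ‖s‖ ^ 2
  norm_q : ‖q‖ ≤ 1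
  bt_eq : bt = b + σ • q
  r_nonneg : 0 ≤ r
  r_le : r ≤ cauchyRadius A bt ρ

/-- The coordinates of the iterates in the eigenbasis, relative to those of `-bt`. -/
noncomputable def relCoord (A : Matrix (Fin d) (Fin d) ℝ) (hA : A.IsHermitian) (bt : E d)
    (ρ η r : ℝ) : ℕ → Fin d → ℝ
  | 0 => fun _ => r / ‖bt‖
  | t + 1 => fun i => relCoord A hA bt ρ η r t i +
      η * slack hA.eigenvalues ρ ‖iterate A bt ρ η r t‖ (relCoord A hA bt ρ η r t) i

lemma iterate_succ {A : Matrix (Fin d) (Fin d) ℝ} (hA : A.IsHermitian) (bt : E d) (ρ η r : ℝ)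
    (t : ℕ) : iterate A bt ρ η r (t + 1) =
      iterate A bt ρ η r t - η • grad A bt ρ (iterate A bt ρ η r t) := by
  rw [← gradient_objective hA]
  rfl

lemma inner_eigenvector_iterate {A : Matrix (Fin d) (Fin d) ℝ} (hA : A.IsHermitian) (bt : E d)
    (ρ η r : ℝ) (t : ℕ) (i : Fin d) :
    inner ℝ (hA.eigenvectorBasis i) (iterate A bt ρ η r t) =
      -(inner ℝ (hA.eigenvectorBasis i) bt * relCoord A hA bt ρ η r t i) := by
  induction t with
  | zero =>
    change inner ℝ _ (-((r / ‖bt‖) • bt)) = _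
    rw [inner_neg_right, real_inner_smul_right, relCoord]
    ring
  | succ t ih =>
    rw [iterate_succ hA, inner_sub_right, real_inner_smul_right, grad, inner_add_right,
      inner_add_right, real_inner_smul_right, inner_eigenvector_op, ih, relCoord]
    simp only [slack]
    ring

lemma norm_sq_iterate {A : Matrix (Fin d) (Fin d) ℝ} (hA : A.IsHermitian) (bt : E d)
    (ρ η r : ℝ) (t : ℕ) : ‖iterate A bt ρ η r t‖ ^ 2 =
      ∑ i, (inner ℝ (hA.eigenvectorBasis i) bt : ℝ) ^ 2 * relCoord A hA bt ρ η r t i ^ 2 := by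
  rw [← sum_sq_inner_eigenvector hA]
  refine Finset.sum_congr rfl fun i _ => ?_
  rw [inner_eigenvector_iterate]
  ring

/-- The Cauchy radius is the larger root of this quadratic. The inequality says that the derivative
of the objective along the ray through `-bt` is still nonpositive at distance `r`. -/
lemma cauchyRadius_sq_le {A : Matrix (Fin d) (Fin d) ℝ} {bt : E d} {ρ r : ℝ} (hρ : 0 < ρ)
    (h0 : 0 ≤ r) (hr : r ≤ cauchyRadius A bt ρ) :
    ρ * r ^ 2 + inner ℝ bt (op A bt) / ‖bt‖ ^ 2 * r ≤ ‖bt‖ := by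
  unfold cauchyRadius at hr
  rw [neg_div] at hr
  set a : ℝ := inner ℝ bt (op A bt) / (2 * ρ * ‖bt‖ ^ 2) with ha
  have h1 : inner ℝ bt (op A bt) / ‖bt‖ ^ 2 = 2 * ρ * a := by
    rw [ha, mul_assoc 2 ρ, ← mul_assoc, div_mul_eq_div_div]
    field_simp
  have h2 : r + a ≤ √(a ^ 2 + ‖bt‖ / ρ) := by linarith
  have h3 : r ^ 2 + 2 * a * r ≤ ‖bt‖ / ρ := by
    rcases le_or_gt (r + a) 0 with h | h
    · have : 0 ≤ ‖bt‖ / ρ := by positivity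
      nlinarith
    · have := (Real.le_sqrt' h).1 h2
      linarith
  rw [le_div_iff₀ hρ] at h3
  rw [h1]
  linarith

namespace PerturbedDescent

variable {A : Matrix (Fin d) (Fin d) ℝ} {b s q bt : E d} {ρ σ r : ℝ}

lemma norm_pos (h : PerturbedDescent A b ρ s σ q bt r) : 0 < ‖s‖ := norm_pos_iff.2 h.ne_zero

lemma norm_le_radius (h : PerturbedDescent A b ρ s σ q bt r) : ‖s‖ ≤ radius A b ρ :=
  CubicGD.norm_le_radius h.hA h.rho_pos h.isMinOn

lemma radius_pos (h : PerturbedDescent A b ρ s σ q bt r) : 0 < radius A b ρ :=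
  h.norm_pos.trans_le h.norm_le_radius

lemma denom_pos (h : PerturbedDescent A b ρ s σ q bt r) : 0 < opNorm A + ρ * radius A b ρ :=
  add_pos_of_nonneg_of_pos opNorm_nonneg (mul_pos h.rho_pos h.radius_pos)

lemma stepSize_mul (h : PerturbedDescent A b ρ s σ q bt r) :
    stepSize A b ρ * (4 * (opNorm A + ρ * radius A b ρ)) = 1 := by
  have := h.denom_pos
  unfold stepSize
  field_simp

lemma stepSize_pos (h : PerturbedDescent A b ρ s σ q bt r) : 0 < stepSize A b ρ := by
  have := h.denom_pos
  unfold stepSize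
  positivity

/-- The perturbation adds at most `ρR²/12` to `‖b‖ = ρR² - βR`. This is the origin of the factor
`13/12` in the bounds on the iterates. -/
lemma norm_bt_le (h : PerturbedDescent A b ρ s σ q bt r) :
    ‖bt‖ ≤ 13 / 12 * ρ * radius A b ρ ^ 2 - opNorm A * radius A b ρ := by
  have h1 : ‖bt‖ ≤ ‖b‖ + σ := by
    rw [h.bt_eq]
    refine (norm_add_le _ _).trans (add_le_add le_rfl ?_)
    rw [norm_smul, Real.norm_of_nonneg h.sigma_nonneg]
    exact mul_le_of_le_one_right h.sigma_nonneg h.norm_q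
  have h2 := radius_sq (A := A) (b := b) h.rho_pos
  have h3 := h.sigma_le
  have h4 : ρ * ‖s‖ ^ 2 ≤ ρ * radius A b ρ ^ 2 :=
    mul_le_mul_of_nonneg_left (pow_le_pow_left₀ h.norm_pos.le h.norm_le_radius 2) h.rho_pos.le
  linarith

lemma norm_init_le (h : PerturbedDescent A b ρ s σ q bt r) (η : ℝ) :
    ‖iterate A bt ρ η r 0‖ ≤ r := by
  change ‖-((r / ‖bt‖) • bt)‖ ≤ r
  rw [norm_neg, norm_smul, Real.norm_of_nonneg (div_nonneg h.r_nonneg (norm_nonneg _))]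
  rcases eq_or_ne ‖bt‖ 0 with h0 | h0
  · rw [h0, mul_zero]; exact h.r_nonneg
  · rw [div_mul_cancel₀ _ h0]

lemma r_le_radius (h : PerturbedDescent A b ρ s σ q bt r) : r ≤ 13 / 12 * radius A b ρ := by
  have h1 := cauchyRadius_sq_le h.rho_pos h.r_nonneg h.r_le
  have h2 : -opNorm A ≤ inner ℝ bt (op A bt) / ‖bt‖ ^ 2 := by
    rcases eq_or_ne bt 0 with h0 | h0
    · simp [h0, opNorm_nonneg]
    · have : 0 < ‖bt‖ := norm_pos_iff.2 h0
      rw [le_div_iff₀ (by positivity)]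
      have := (abs_le.1 (abs_inner_op_le (A := A) bt bt)).1
      linarith
  have h3 := h.norm_bt_le
  have h4 := opNorm_le_radius (A := A) (b := b) h.rho_pos
  have h5 := h.radius_pos
  have h6 : -opNorm A * r ≤ inner ℝ bt (op A bt) / ‖bt‖ ^ 2 * r :=
    mul_le_mul_of_nonneg_right h2 h.r_nonneg
  have hρ := h.rho_pos
  set R := radius A b ρ
  by_contra hc
  push Not at hc
  have h7 : 0 < (r - 13 / 12 * R) * (ρ * r - opNorm A) := by
    refine mul_pos (by linarith) ?_
    nlinarith
  have h8 : 0 ≤ (r - 13 / 12 * R) * ρ * R := mul_nonneg (mul_nonneg (by linarith) hρ.le) h5.le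
  have h9 : 0 ≤ (ρ * R - opNorm A) * R := mul_nonneg (by linarith) h5.le
  have h10 : 0 < ρ * R ^ 2 := by positivity
  nlinarith

/-- A crude invariant ball, needed before monotonicity: it certifies that the step size is small
enough for `Admissible.step`. -/
lemma norm_iterate_le_radius (h : PerturbedDescent A b ρ s σ q bt r) (t : ℕ) :
    ‖iterate A bt ρ (stepSize A b ρ) r t‖ ≤ 13 / 12 * radius A b ρ := by
  induction t with
  | zero => exact (h.norm_init_le _).trans h.r_le_radius
  | succ t ih =>
    rw [iterate_succ h.hA]
    set x := iterate A bt ρ (stepSize A b ρ) r t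
    have hη := h.stepSize_mul
    have hη0 := h.stepSize_pos
    set η := stepSize A b ρ
    have h3 := h.norm_bt_le
    have h4 := opNorm_le_radius (A := A) (b := b) h.rho_pos
    have h5 := h.radius_pos
    have hρ := h.rho_pos
    have hβ := opNorm_nonneg (A := A)
    set R := radius A b ρ
    set n := ‖x‖ with hn
    have hn0 : 0 ≤ n := norm_nonneg _
    have hR : η * (ρ * R) ≤ 1 / 4 := by
      have := mul_nonneg hη0.le hβ
      linarith
    have hηn : η * (ρ * n) ≤ 13 / 48 := by
      have := mul_le_mul_of_nonneg_left (mul_le_mul_of_nonneg_left ih hρ.le) hη0.le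
      linarith
    have e : x - η • grad A bt ρ x = (1 - η * (ρ * n)) • x - η • (op A x) - η • bt := by
      rw [grad, ← hn]; module
    have h6 : ‖x - η • grad A bt ρ x‖ ≤
        (1 - η * (ρ * n)) * n + η * (opNorm A * n) + η * ‖bt‖ := by
      rw [e]
      refine (norm_sub_le _ _).trans (add_le_add ((norm_sub_le _ _).trans (add_le_add ?_ ?_)) ?_)
      · rw [norm_smul, Real.norm_of_nonneg (by linarith)]
      · rw [norm_smul, Real.norm_of_nonneg hη0.le]
        exact mul_le_mul_of_nonneg_left ((op A).le_opNorm x) hη0.le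
      · rw [norm_smul, Real.norm_of_nonneg hη0.le]
    refine h6.trans ?_
    have h7 := mul_le_mul_of_nonneg_left h3 hη0.le
    -- The bound on the new norm increases with `n` up to `13/12 * R`, and there it is at most
    -- `13/12 * R` because `β ≤ ρR`.
    have h8 : 0 ≤ (13 / 12 * R - n) * (1 - η * (ρ * n) - η * (ρ * (13 / 12 * R))) :=
      mul_nonneg (by linarith) (by linarith)
    have h9 : 0 ≤ η * opNorm A * (13 / 12 * R - n) :=
      mul_nonneg (mul_nonneg hη0.le hβ) (by linarith)
    have h10 : 0 ≤ η * R * (ρ * R - opNorm A) :=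
      mul_nonneg (mul_nonneg hη0.le h5.le) (by linarith)
    have h11 : 0 ≤ η * R * (ρ * R) := by positivity
    nlinarith

lemma admissible (h : PerturbedDescent A b ρ s σ q bt r) (t : ℕ) :
    Admissible (fun i => (inner ℝ (h.hA.eigenvectorBasis i) bt : ℝ) ^ 2) h.hA.eigenvalues ρ
      ‖iterate A bt ρ (stepSize A b ρ) r t‖ (relCoord A h.hA bt ρ (stepSize A b ρ) r t) := by
  induction t with
  | zero =>
    refine admissible_const (c := r / ‖bt‖) (fun i => rfl)
      (div_nonneg h.r_nonneg (norm_nonneg _)) ?_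
    have hn := h.norm_init_le (stepSize A b ρ)
    set n := ‖iterate A bt ρ (stepSize A b ρ) r 0‖
    have h1 := cauchyRadius_sq_le h.rho_pos h.r_nonneg h.r_le
    have e : ∑ i, (inner ℝ (h.hA.eigenvectorBasis i) bt : ℝ) ^ 2 *
        relCoord A h.hA bt ρ (stepSize A b ρ) r 0 i *
        slack h.hA.eigenvalues ρ n (relCoord A h.hA bt ρ (stepSize A b ρ) r 0) i =
        r / ‖bt‖ * (‖bt‖ ^ 2 - r / ‖bt‖ * (inner ℝ bt (op A bt) + ρ * n * ‖bt‖ ^ 2)) := by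
      rw [inner_op_eq_sum h.hA, ← sum_sq_inner_eigenvector h.hA bt]
      simp only [Finset.mul_sum, ← Finset.sum_add_distrib, ← Finset.sum_sub_distrib]
      refine Finset.sum_congr rfl fun i _ => ?_
      simp only [relCoord, slack]
      ring
    rw [e]
    rcases eq_or_ne bt 0 with h0 | h0
    · simp [h0]
    have hb : 0 < ‖bt‖ := norm_pos_iff.2 h0
    refine mul_nonneg (div_nonneg h.r_nonneg hb.le) ?_
    have e2 : ‖bt‖ ^ 2 - r / ‖bt‖ * (inner ℝ bt (op A bt) + ρ * n * ‖bt‖ ^ 2) =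
        ‖bt‖ * (‖bt‖ - (ρ * n * r + inner ℝ bt (op A bt) / ‖bt‖ ^ 2 * r)) := by
      field_simp
      ring
    rw [e2]
    have h2 : ρ * n * r ≤ ρ * r ^ 2 := by
      rw [sq, ← mul_assoc]
      exact mul_le_mul_of_nonneg_right (mul_le_mul_of_nonneg_left hn h.rho_pos.le) h.r_nonneg
    exact mul_nonneg hb.le (by linarith)
  | succ t ih =>
    refine ih.step (fun i => sq_nonneg _) h.stepSize_pos h.rho_pos (norm_nonneg _) (norm_nonneg _)
      (norm_sq_iterate h.hA _ _ _ _ _) (norm_sq_iterate h.hA _ _ _ _ _) (fun i => rfl) fun i => ?_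
    -- The condition on the step reduces to `β + 3 * (13/12) * ρR < 4 (β + ρR)`.
    have h1 := h.norm_iterate_le_radius t
    have h2 := h.norm_iterate_le_radius (t + 1)
    have hη := h.stepSize_mul
    have h3 := (abs_le.1 (abs_eigenvalue_le h.hA i)).2
    have hβ := opNorm_nonneg (A := A)
    have h4 := mul_le_mul_of_nonneg_left h1 h.rho_pos.le
    have h5 := mul_le_mul_of_nonneg_left h2 h.rho_pos.le
    have h6 := mul_pos h.rho_pos h.radius_pos
    rw [← hη]
    exact mul_lt_mul_of_pos_left (by linarith) h.stepSize_pos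

lemma norm_iterate_mono (h : PerturbedDescent A b ρ s σ q bt r) :
    Monotone fun t => ‖iterate A bt ρ (stepSize A b ρ) r t‖ :=
  monotone_nat_of_le_succ fun t =>
    (h.admissible t).norm_le (fun _ => sq_nonneg _) h.stepSize_pos (norm_nonneg _)
      (norm_sq_iterate h.hA _ _ _ _ _) (norm_sq_iterate h.hA _ _ _ _ _) (fun _ => rfl)

/-- If `n > 2‖s‖`, then `λ i + ρ n` dominates both `λ i + ρ‖s‖` and `ρ‖s‖`. Stationarity of `s`
expresses `bt` through `s` and `q`, so `Admissible.sq_le` gives `n² ≤ (2 + 2/144)‖s‖²`, a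
contradiction. -/
lemma norm_iterate_le (h : PerturbedDescent A b ρ s σ q bt r) (t : ℕ) :
    ‖iterate A bt ρ (stepSize A b ρ) r t‖ ≤ 2 * ‖s‖ := by
  have had := h.admissible t
  have hns := norm_sq_iterate h.hA bt ρ (stepSize A b ρ) r t
  set n := ‖iterate A bt ρ (stepSize A b ρ) r t‖
  by_contra hc
  push Not at hc
  have hS := h.norm_pos
  have hρ := h.rho_pos
  have ha := eigenvalue_add_nonneg h.hA hρ h.isMinOn h.ne_zero
  have hρn : ρ * ‖s‖ ≤ ρ * n - ρ * ‖s‖ := by nlinarith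
  have hρS : 0 < ρ * ‖s‖ := mul_pos hρ hS
  have hpos : ∀ i, 0 < h.hA.eigenvalues i + ρ * n := fun i => by linarith [ha i]
  have h1 := had.sq_le (fun _ => sq_nonneg _) hns hpos
  have hbi : ∀ i, (inner ℝ (h.hA.eigenvectorBasis i) bt : ℝ) =
      -((h.hA.eigenvalues i + ρ * ‖s‖) * inner ℝ (h.hA.eigenvectorBasis i) s) +
        σ * inner ℝ (h.hA.eigenvectorBasis i) q := fun i => by
    have h2 := congrArg (fun x => (inner ℝ (h.hA.eigenvectorBasis i) x : ℝ))
      (grad_eq_zero h.hA h.isMinOn)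
    simp only [grad, inner_add_right, inner_eigenvector_op, real_inner_smul_right,
      inner_zero_right] at h2
    have h3 := congrArg (fun x => (inner ℝ (h.hA.eigenvectorBasis i) x : ℝ)) h.bt_eq
    simp only [inner_add_right, real_inner_smul_right] at h3
    linarith
  have h2 : ∑ i, (inner ℝ (h.hA.eigenvectorBasis i) bt : ℝ) ^ 2 / (h.hA.eigenvalues i + ρ * n) ^ 2
      ≤ ∑ i, (2 * (inner ℝ (h.hA.eigenvectorBasis i) s : ℝ) ^ 2 +
        2 * (‖s‖ / 12) ^ 2 * (inner ℝ (h.hA.eigenvectorBasis i) q : ℝ) ^ 2) := by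
    refine Finset.sum_le_sum fun i _ => ?_
    rw [div_le_iff₀ (pow_pos (hpos i) 2), hbi]
    set p : ℝ := inner ℝ (h.hA.eigenvectorBasis i) s
    set u : ℝ := inner ℝ (h.hA.eigenvectorBasis i) q
    set l := h.hA.eigenvalues i + ρ * n with hl
    set a := h.hA.eigenvalues i + ρ * ‖s‖
    have hal : a ≤ l := by linarith
    have hσ : σ ≤ l * (‖s‖ / 12) := by
      have h3 := h.sigma_le
      have h4 : ρ * ‖s‖ * ‖s‖ ≤ l * ‖s‖ :=
        mul_le_mul_of_nonneg_right (by linarith [ha i]) hS.le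
      linarith
    have h3 : a ^ 2 * p ^ 2 ≤ l ^ 2 * p ^ 2 :=
      mul_le_mul_of_nonneg_right (pow_le_pow_left₀ (ha i) hal 2) (sq_nonneg _)
    have h4 : σ ^ 2 * u ^ 2 ≤ (l * (‖s‖ / 12)) ^ 2 * u ^ 2 :=
      mul_le_mul_of_nonneg_right (pow_le_pow_left₀ h.sigma_nonneg hσ 2) (sq_nonneg _)
    have h5 := sq_nonneg (a * p + σ * u)
    linarith
  have h3 : ∑ i, (2 * (inner ℝ (h.hA.eigenvectorBasis i) s : ℝ) ^ 2 +
        2 * (‖s‖ / 12) ^ 2 * (inner ℝ (h.hA.eigenvectorBasis i) q : ℝ) ^ 2) =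
      2 * ‖s‖ ^ 2 + 2 * (‖s‖ / 12) ^ 2 * ‖q‖ ^ 2 := by
    rw [Finset.sum_add_distrib, ← Finset.mul_sum, ← Finset.mul_sum,
      sum_sq_inner_eigenvector h.hA s, sum_sq_inner_eigenvector h.hA q]
  have h4 : 2 * (‖s‖ / 12) ^ 2 * ‖q‖ ^ 2 ≤ 2 * (‖s‖ / 12) ^ 2 :=
    mul_le_of_le_one_right (by positivity) (pow_le_one₀ (norm_nonneg _) h.norm_q)
  nlinarith

/-! ### Growth of the iterates -/

/-- As long as the iterates are short, the coordinate along the bottom eigenvector grows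
exponentially. -/
lemma pow_le_of_norm_lt (h : PerturbedDescent A b ρ s σ q bt r) {i : Fin d}
    (hi : h.hA.eigenvalues i = -gam A h.hA)
    {β₁ : ℝ} (hβ₁ : 0 < β₁) (hb : β₁ ≤ |inner ℝ (h.hA.eigenvectorBasis i) bt|)
    {μ : ℝ} (hμ : 0 < μ) {N : ℕ}
    (hN : ρ * ‖iterate A bt ρ (stepSize A b ρ) r N‖ < gam A h.hA - μ) :
    (1 + stepSize A b ρ * μ) ^ N ≤ 1 + gam A h.hA ^ 2 / (ρ * β₁) := by
  have hη := h.stepSize_pos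
  have hρ := h.rho_pos
  set η := stepSize A b ρ
  set γ := gam A h.hA
  -- The lower bound solves `u ↦ (1 + ημ) u + η` from `0`. Monotonicity of the norm carries the
  -- hypothesis at time `N` back to every earlier time.
  have hgrow : ∀ k ≤ N, ((1 + η * μ) ^ k - 1) / μ ≤ relCoord A h.hA bt ρ η r k i := by
    intro k
    induction k with
    | zero => intro _; simpa using (h.admissible 0).nonneg i
    | succ k ih =>
      intro hk
      have h1 := ih (by omega)
      have h2 := (h.admissible k).nonneg i
      have h3 := mul_le_mul_of_nonneg_left (h.norm_iterate_mono (show k ≤ N by omega)) hρ.le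
      simp only at h3
      set z := relCoord A h.hA bt ρ η r k i with hz
      have e : relCoord A h.hA bt ρ η r (k + 1) i =
          z + η * (1 + (γ - ρ * ‖iterate A bt ρ η r k‖) * z) := by
        rw [relCoord]; simp only [slack, hi]; ring
      rw [e]
      have h4 : μ * z ≤ (γ - ρ * ‖iterate A bt ρ η r k‖) * z :=
        mul_le_mul_of_nonneg_right (by linarith) h2
      have h5 := mul_le_mul_of_nonneg_left h4 hη.le
      rw [div_le_iff₀ hμ] at h1 ⊢
      have h6 : 0 ≤ η * μ := by positivity
      rw [pow_succ]
      nlinarith [mul_le_mul_of_nonneg_right h5 hμ.le, mul_le_mul_of_nonneg_left h1 h6]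
  have h1 := hgrow N le_rfl
  have h2 : β₁ * relCoord A h.hA bt ρ η r N i ≤ ‖iterate A bt ρ η r N‖ := by
    have h3 : |inner ℝ (h.hA.eigenvectorBasis i) (iterate A bt ρ η r N)| ≤
        ‖iterate A bt ρ η r N‖ := by
      have := abs_real_inner_le_norm (h.hA.eigenvectorBasis i) (iterate A bt ρ η r N)
      rwa [h.hA.eigenvectorBasis.orthonormal.1 i, one_mul] at this
    have h4 := (h.admissible N).nonneg i
    rw [inner_eigenvector_iterate, abs_neg, abs_mul, abs_of_nonneg h4] at h3
    exact (mul_le_mul_of_nonneg_right hb h4).trans h3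
  have hγ : 0 ≤ γ - μ := by
    have := mul_nonneg hρ.le (norm_nonneg (iterate A bt ρ η r N))
    linarith
  have h3 : ρ * (β₁ * (((1 + η * μ) ^ N - 1) / μ)) ≤ γ := by
    have := mul_le_mul_of_nonneg_left (mul_le_mul_of_nonneg_left h1 hβ₁.le) hρ.le
    have := mul_le_mul_of_nonneg_left h2 hρ.le
    linarith
  have h4 : (1 + η * μ) ^ N - 1 ≤ γ ^ 2 / (ρ * β₁) := by
    rw [le_div_iff₀ (by positivity)]
    have e : ρ * (β₁ * (((1 + η * μ) ^ N - 1) / μ)) = ((1 + η * μ) ^ N - 1) * (ρ * β₁) / μ := by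
      ring
    rw [e, div_le_iff₀ hμ] at h3
    nlinarith
  linarith

/-! ### Descent -/

lemma objective_succ_le (h : PerturbedDescent A b ρ s σ q bt r) (t : ℕ) :
    objective A bt ρ (iterate A bt ρ (stepSize A b ρ) r (t + 1)) ≤
      objective A bt ρ (iterate A bt ρ (stepSize A b ρ) r t) -
        stepSize A b ρ / 2 * ‖grad A bt ρ (iterate A bt ρ (stepSize A b ρ) r t)‖ ^ 2 := by
  have h1 := h.norm_iterate_le_radius t
  have h2 := h.norm_iterate_le_radius (t + 1)
  rw [iterate_succ h.hA, sub_eq_add_neg] at h2 ⊢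
  set x := iterate A bt ρ (stepSize A b ρ) r t
  set G := grad A bt ρ x with hG
  have hη := h.stepSize_mul
  have hη0 := h.stepSize_pos
  have hρ := h.rho_pos
  set η := stepSize A b ρ
  have hβ := opNorm_nonneg (A := A)
  set R := radius A b ρ
  rw [objective_add h.hA, ← hG]
  set u := -(η • G) with hu
  have hu1 : (inner ℝ G u : ℝ) = -η * ‖G‖ ^ 2 := by
    rw [hu, inner_neg_right, real_inner_smul_right, real_inner_self_eq_norm_sq]; ring
  have hu2 : ‖u‖ ^ 2 = η ^ 2 * ‖G‖ ^ 2 := by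
    rw [hu, norm_neg, norm_smul, mul_pow, Real.norm_eq_abs, sq_abs]
  have hu3 := (abs_le.1 (abs_inner_op_le (A := A) u u)).2
  have hd : (‖x + u‖ - ‖x‖) ^ 2 ≤ ‖u‖ ^ 2 := by
    have := abs_norm_sub_norm_le (x + u) x
    rw [add_sub_cancel_left] at this
    exact sq_le_sq.2 (by rwa [abs_of_nonneg (norm_nonneg u)])
  have h3 : (‖x + u‖ - ‖x‖) ^ 2 * (2 * ‖x + u‖ + ‖x‖) ≤ ‖u‖ ^ 2 * (3 * (13 / 12 * R)) :=
    mul_le_mul hd (by linarith) (by positivity) (sq_nonneg _)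
  have h4 : ‖x‖ * ‖u‖ ^ 2 ≤ 13 / 12 * R * ‖u‖ ^ 2 := mul_le_mul_of_nonneg_right h1 (sq_nonneg _)
  have h5 : ρ * ((‖x + u‖ - ‖x‖) ^ 2 * (2 * ‖x + u‖ + ‖x‖) / 6 + ‖x‖ * ‖u‖ ^ 2 / 2) ≤
      ρ * (13 / 12 * R * ‖u‖ ^ 2) := mul_le_mul_of_nonneg_left (by linarith) hρ.le
  have h6 : (opNorm A / 2 + ρ * (13 / 12 * R)) * ‖u‖ ^ 2 ≤ η / 2 * ‖G‖ ^ 2 := by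
    rw [hu2]
    have h7 : η * (opNorm A / 2 + ρ * (13 / 12 * R)) ≤ 1 / 2 := by
      have h8 := mul_nonneg hη0.le hβ
      have h9 := mul_nonneg hη0.le (mul_nonneg hρ.le h.radius_pos.le)
      linarith
    have := mul_le_mul_of_nonneg_right h7 (mul_nonneg hη0.le (sq_nonneg ‖G‖))
    linarith
  rw [hu1]
  linarith

lemma objective_antitone (h : PerturbedDescent A b ρ s σ q bt r) :
    Antitone fun t => objective A bt ρ (iterate A bt ρ (stepSize A b ρ) r t) :=
  antitone_nat_of_succ_le fun t => (h.objective_succ_le t).trans (sub_le_self _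
    (mul_nonneg (half_pos h.stepSize_pos).le (sq_nonneg _)))

lemma objective_init_nonpos (h : PerturbedDescent A b ρ s σ q bt r) (η : ℝ) :
    objective A bt ρ (iterate A bt ρ η r 0) ≤ 0 := by
  have hn := h.norm_init_le η
  have h1 := cauchyRadius_sq_le h.rho_pos h.r_nonneg h.r_le
  have hρ := h.rho_pos
  have hr := h.r_nonneg
  rcases eq_or_ne bt 0 with h0 | h0
  · change objective A bt ρ (-((r / ‖bt‖) • bt)) ≤ 0
    simp [objective, h0]
  have hb : 0 < ‖bt‖ := norm_pos_iff.2 h0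
  have hn3 := mul_le_mul_of_nonneg_left (pow_le_pow_left₀ (norm_nonneg _) hn 3)
    (show 0 ≤ ρ / 3 by positivity)
  unfold objective
  set a := (inner ℝ bt (op A bt) : ℝ) with ha
  have e1 : (inner ℝ (iterate A bt ρ η r 0) (op A (iterate A bt ρ η r 0)) : ℝ) =
      a / ‖bt‖ ^ 2 * r ^ 2 := by
    change inner ℝ (-((r / ‖bt‖) • bt)) (op A (-((r / ‖bt‖) • bt))) = _
    rw [map_neg, map_smul, inner_neg_neg, real_inner_smul_left, real_inner_smul_right, ← ha]
    field_simp
  have e2 : (inner ℝ bt (iterate A bt ρ η r 0) : ℝ) = -(‖bt‖ * r) := by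
    change inner ℝ bt (-((r / ‖bt‖) • bt)) = _
    rw [inner_neg_right, real_inner_smul_right, real_inner_self_eq_norm_sq]
    field_simp
  rw [e1, e2]
  have h2 := mul_le_mul_of_nonneg_right h1 hr
  have h3 : 0 ≤ ρ * r ^ 3 := by positivity
  have h4 : 0 ≤ ‖bt‖ * r := by positivity
  linarith

lemma objective_bt (h : PerturbedDescent A b ρ s σ q bt r) (x : E d) :
    objective A bt ρ x = objective A b ρ x + σ * inner ℝ q x := by
  simp only [objective, h.bt_eq, inner_add_left, real_inner_smul_left]
  ring

/-- The potential `‖x_t - s‖² + 2η (f̃(x_t) - f̃(s))`. -/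
noncomputable def potential (A : Matrix (Fin d) (Fin d) ℝ) (b bt s : E d) (ρ r : ℝ) (t : ℕ) : ℝ :=
  ‖iterate A bt ρ (stepSize A b ρ) r t - s‖ ^ 2 + 2 * stepSize A b ρ *
    (objective A bt ρ (iterate A bt ρ (stepSize A b ρ) r t) - objective A bt ρ s)

/-- The weight `2η` is chosen so that the guaranteed decrease of the objective cancels the term
`η²‖∇f̃‖²` from expanding the square. -/
lemma potential_succ_le (h : PerturbedDescent A b ρ s σ q bt r) (t : ℕ) :
    potential A b bt s ρ r (t + 1) ≤ potential A b bt s ρ r t -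
      2 * stepSize A b ρ * inner ℝ (grad A bt ρ (iterate A bt ρ (stepSize A b ρ) r t))
        (iterate A bt ρ (stepSize A b ρ) r t - s) := by
  have h1 := h.objective_succ_le t
  have h0 := h.stepSize_pos
  unfold potential
  have e : iterate A bt ρ (stepSize A b ρ) r (t + 1) - s =
      (iterate A bt ρ (stepSize A b ρ) r t - s) -
        stepSize A b ρ • grad A bt ρ (iterate A bt ρ (stepSize A b ρ) r t) := by
    rw [iterate_succ h.hA]; abel
  rw [e, norm_sub_sq_real, real_inner_smul_right, norm_smul, mul_pow, Real.norm_eq_abs, sq_abs,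
    real_inner_comm]
  have h2 := mul_le_mul_of_nonneg_left h1 h0.le
  linarith

/-- Written to be compared with `objective_sub`. The only harmful term is `-(ρ/2)(‖s‖ - ‖x‖)‖x -
s‖²`, which is controlled once `ρ‖x‖` is nearly `γ`. -/
lemma inner_grad_sub (h : PerturbedDescent A b ρ s σ q bt r) (x : E d) :
    inner ℝ (grad A bt ρ x) (x - s) = inner ℝ (x - s) (op A (x - s)) + ρ * ‖s‖ * ‖x - s‖ ^ 2 -
      1 / 2 * ρ * (‖s‖ - ‖x‖) * ‖x - s‖ ^ 2 + 1 / 2 * ρ * (‖s‖ - ‖x‖) ^ 2 * (‖s‖ + ‖x‖) +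
      σ * inner ℝ q (x - s) := by
  have e : grad A bt ρ x = op A (x - s) + (ρ * ‖s‖) • (x - s) - (ρ * (‖s‖ - ‖x‖)) • x +
      σ • q := by
    have h1 : op A s + b + (ρ * ‖s‖) • s = 0 := grad_eq_zero h.hA h.isMinOn
    have h2 : b = -(op A s + (ρ * ‖s‖) • s) := by
      rw [eq_neg_iff_add_eq_zero, ← h1]; abel
    rw [grad, h.bt_eq, h2, map_sub]
    module
  have h3 : (inner ℝ x (x - s) : ℝ) = (‖x‖ ^ 2 - ‖s‖ ^ 2 + ‖x - s‖ ^ 2) / 2 := by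
    rw [norm_sub_sq_real, inner_sub_right, real_inner_self_eq_norm_sq]; ring
  rw [e, inner_add_left, inner_sub_left, inner_add_left, real_inner_smul_left,
    real_inner_smul_left, real_inner_smul_left, h3, real_inner_self_eq_norm_sq,
    real_inner_comm (x - s) (op A (x - s))]
  ring

lemma objective_sub (h : PerturbedDescent A b ρ s σ q bt r) (x : E d) :
    objective A b ρ x - objective A b ρ s =
      1 / 2 * (inner ℝ (x - s) (op A (x - s)) + ρ * ‖s‖ * ‖x - s‖ ^ 2) +
      ρ / 6 * ((‖s‖ - ‖x‖) ^ 2 * (‖s‖ + 2 * ‖x‖)) := by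
  have := objective_eq_of_isMinOn h.hA h.isMinOn (x - s)
  rw [add_sub_cancel] at this
  rw [this]; ring

end PerturbedDescent

end Trajectory

end CubicGD

/-! ### Convergence rates before and after the norm has grown. -/

namespace CubicGD

namespace PerturbedDescent

variable {d : ℕ} {A : Matrix (Fin d) (Fin d) ℝ} {b s q bt : E d} {ρ σ r ε μ : ℝ}

lemma smoothness_pos (h : PerturbedDescent A b ρ s σ q bt r) : 0 < smoothness A ρ s := by
  have h1 := opNorm_nonneg (A := A)
  have h2 := mul_pos h.rho_pos h.norm_pos
  unfold smoothness
  linarith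

lemma stepSize_mul_smoothness_le (h : PerturbedDescent A b ρ s σ q bt r) :
    stepSize A b ρ * smoothness A ρ s ≤ 1 / 2 := by
  have h1 := h.stepSize_mul
  have h2 := mul_le_mul_of_nonneg_left h.norm_le_radius h.rho_pos.le
  have h3 := opNorm_nonneg (A := A)
  have h4 : smoothness A ρ s ≤ 2 * (opNorm A + ρ * radius A b ρ) := by
    unfold smoothness; linarith
  have := mul_le_mul_of_nonneg_left h4 h.stepSize_pos.le
  linarith

lemma one_le_stepSize_mul_smoothness (h : PerturbedDescent A b ρ s σ q bt r) :
    1 ≤ 8 * (stepSize A b ρ * smoothness A ρ s) := by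
  have h1 := h.stepSize_mul
  have h2 := radius_le h.hA h.rho_pos h.isMinOn
  have h3 := opNorm_nonneg (A := A)
  have h5 := mul_pos h.rho_pos h.norm_pos
  have h4 : opNorm A + ρ * radius A b ρ ≤ 2 * smoothness A ρ s := by
    unfold smoothness; linarith
  have := mul_le_mul_of_nonneg_left h4 h.stepSize_pos.le
  linarith

lemma norm_sub_le (h : PerturbedDescent A b ρ s σ q bt r) (t : ℕ) :
    ‖iterate A bt ρ (stepSize A b ρ) r t - s‖ ≤ 3 * ‖s‖ := by
  have := _root_.norm_sub_le (iterate A bt ρ (stepSize A b ρ) r t) s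
  have := h.norm_iterate_le t
  linarith

lemma abs_sigma_inner_le (h : PerturbedDescent A b ρ s σ q bt r) (x : E d) :
    |σ * inner ℝ q x| ≤ σ * ‖x‖ := by
  rw [abs_mul, abs_of_nonneg h.sigma_nonneg]
  refine mul_le_mul_of_nonneg_left ((abs_real_inner_le_norm q x).trans ?_) h.sigma_nonneg
  exact mul_le_of_le_one_left (norm_nonneg _) h.norm_q

lemma abs_perturbation_le (h : PerturbedDescent A b ρ s σ q bt r) (hε : 24 * σ * ‖s‖ ≤ ε)
    (t : ℕ) : |σ * inner ℝ q (iterate A bt ρ (stepSize A b ρ) r t - s)| ≤ ε / 8 := by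
  have h1 := h.abs_sigma_inner_le (iterate A bt ρ (stepSize A b ρ) r t - s)
  have h2 := mul_le_mul_of_nonneg_left (h.norm_sub_le t) h.sigma_nonneg
  linarith

lemma objective_bt_sub (h : PerturbedDescent A b ρ s σ q bt r) (x : E d) :
    objective A bt ρ x - objective A bt ρ s =
      objective A b ρ x - objective A b ρ s + σ * inner ℝ q (x - s) := by
  rw [h.objective_bt, h.objective_bt, inner_sub_right]
  ring

lemma objective_bt_sub_le (h : PerturbedDescent A b ρ s σ q bt r) (hε : 24 * σ * ‖s‖ ≤ ε)
    (t : ℕ) : objective A bt ρ (iterate A bt ρ (stepSize A b ρ) r t) - objective A bt ρ s ≤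
      1 / 2 * (smoothness A ρ s * ‖s‖ ^ 2) + ε / 24 := by
  have h1 := (h.objective_antitone (Nat.zero_le t)).trans (h.objective_init_nonpos _)
  have h2 := h.objective_sub 0
  have h3 : objective A b ρ 0 = 0 := by simp [objective]
  rw [h3, zero_sub, zero_sub, map_neg, inner_neg_neg, norm_neg, norm_zero] at h2
  have h4 := (abs_le.1 (abs_inner_op_le (A := A) s s)).2
  have h5 := (abs_le.1 (h.abs_sigma_inner_le s)).1
  have h6 := h.objective_bt s
  have h7 : 0 ≤ ρ * ‖s‖ ^ 3 := mul_nonneg h.rho_pos.le (by positivity)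
  unfold smoothness
  simp only at h1
  linarith

lemma potential_le (h : PerturbedDescent A b ρ s σ q bt r) (hε : 24 * σ * ‖s‖ ≤ ε)
    (hεL : ε ≤ smoothness A ρ s * ‖s‖ ^ 2) (t : ℕ) :
    potential A b bt s ρ r t ≤ 10 * ‖s‖ ^ 2 := by
  have h1 := h.objective_bt_sub_le hε t
  have h2 : ‖iterate A bt ρ (stepSize A b ρ) r t - s‖ ^ 2 ≤ (3 * ‖s‖) ^ 2 :=
    pow_le_pow_left₀ (norm_nonneg _) (h.norm_sub_le t) 2
  have h3 : 0 ≤ smoothness A ρ s * ‖s‖ ^ 2 := mul_nonneg h.smoothness_pos.le (sq_nonneg _)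
  have h4 := mul_le_mul_of_nonneg_left (h1.trans (show _ ≤ smoothness A ρ s * ‖s‖ ^ 2 by linarith))
    h.stepSize_pos.le
  have h5 := mul_le_mul_of_nonneg_right h.stepSize_mul_smoothness_le (sq_nonneg ‖s‖)
  unfold potential
  linarith

/-- An iterate with a large gap is possible only if the accuracy is not trivial. -/
lemma five_mul_le (h : PerturbedDescent A b ρ s σ q bt r) (hε : 24 * σ * ‖s‖ ≤ ε) {t : ℕ}
    (ht : objective A b ρ s + ε < objective A b ρ (iterate A bt ρ (stepSize A b ρ) r t)) :
    5 * ε ≤ 3 * (smoothness A ρ s * ‖s‖ ^ 2) := by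
  have h1 := h.objective_bt_sub_le hε t
  rw [h.objective_bt_sub] at h1
  have h2 := (abs_le.1 (h.abs_perturbation_le hε t)).1
  linarith

/-- Since `f̃` decreases along the iterates, a failure at time `t` forces a large gap at every
earlier time. The rate arguments are run backwards from such a failure. -/
lemma gap_ge (h : PerturbedDescent A b ρ s σ q bt r) (hε : 24 * σ * ‖s‖ ≤ ε) {t k : ℕ}
    (hk : k ≤ t)
    (ht : objective A b ρ s + ε < objective A b ρ (iterate A bt ρ (stepSize A b ρ) r t)) :
    7 / 8 * ε ≤
      objective A bt ρ (iterate A bt ρ (stepSize A b ρ) r k) - objective A bt ρ s := by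
  have h1 := h.objective_antitone hk
  have h2 := h.objective_bt_sub (iterate A bt ρ (stepSize A b ρ) r t)
  have h3 := (abs_le.1 (h.abs_perturbation_le hε t)).1
  simp only at h1
  linarith

lemma gam_le (h : PerturbedDescent A b ρ s σ q bt r) (hd : 0 < d) :
    gam A h.hA ≤ ρ * ‖s‖ := CubicGD.gam_le h.hA hd h.rho_pos h.isMinOn h.ne_zero

/-- Here `⟨∇f̃(x), x - s⟩` is at least the gap minus `μ‖x - s‖²/2`, hence at least `7ε/8 - ε/8`,
using `‖x - s‖ ≤ 3‖s‖`. -/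
lemma potential_succ_le_sub (h : PerturbedDescent A b ρ s σ q bt r) (hd : 0 < d)
    (hε : 24 * σ * ‖s‖ ≤ ε) (hμ : 36 * μ * ‖s‖ ^ 2 ≤ ε) (hμ0 : 0 < μ) {t k : ℕ} (hk : k ≤ t)
    (ht : objective A b ρ s + ε < objective A b ρ (iterate A bt ρ (stepSize A b ρ) r t))
    (hreg : gam A h.hA - μ ≤ ρ * ‖iterate A bt ρ (stepSize A b ρ) r k‖) :
    potential A b bt s ρ r (k + 1) ≤ potential A b bt s ρ r k - stepSize A b ρ * ε := by
  have h1 := h.potential_succ_le k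
  have h2 := h.gap_ge hε hk ht
  have h3 := h.inner_grad_sub (iterate A bt ρ (stepSize A b ρ) r k)
  have h4 := h.objective_sub (iterate A bt ρ (stepSize A b ρ) r k)
  have h5 := h.objective_bt_sub (iterate A bt ρ (stepSize A b ρ) r k)
  have h6 := abs_le.1 (h.abs_perturbation_le hε k)
  have h7 := h.norm_sub_le k
  have h8 := neg_gam_mul_le_inner h.hA (iterate A bt ρ (stepSize A b ρ) r k - s)
  have h9 := h.gam_le hd
  have hρ := h.rho_pos
  have hS := h.norm_pos
  set x := iterate A bt ρ (stepSize A b ρ) r k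
  set Q : ℝ := inner ℝ (x - s) (op A (x - s))
  set Y := ‖x - s‖
  have h7' : Y ^ 2 ≤ (3 * ‖s‖) ^ 2 := pow_le_pow_left₀ (norm_nonneg _) h7 2
  have h10 : 0 ≤ (ρ * ‖x‖ - (gam A h.hA - μ)) * Y ^ 2 := mul_nonneg (by linarith) (sq_nonneg _)
  have h11 : 0 ≤ ρ * ((‖s‖ - ‖x‖) ^ 2 * (2 * ‖s‖ + ‖x‖)) := by positivity
  have h12 : μ * Y ^ 2 ≤ μ * (3 * ‖s‖) ^ 2 := mul_le_mul_of_nonneg_left h7' hμ0.le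
  have h13 : 1 / 2 * ε ≤ inner ℝ (grad A bt ρ x) (x - s) := by
    rw [h3]; linarith
  have h14 := mul_le_mul_of_nonneg_left h13 h.stepSize_pos.le
  linarith

/-- With `κ = ρ‖s‖ - γ`, the form `A + ρ‖s‖` is bounded below by `κ`. Keeping a quarter of the gap
leaves `7κ/8` of curvature, of which the norm deficit uses `3κ/4`. The remaining `κ/8` and the kept
part of the gap contract both terms of the potential. -/
lemma potential_succ_le_mul (h : PerturbedDescent A b ρ s σ q bt r) (hd : 0 < d)
    (hε : 24 * σ * ‖s‖ ≤ ε) {t k : ℕ} (hk : k ≤ t)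
    (ht : objective A b ρ s + ε < objective A b ρ (iterate A bt ρ (stepSize A b ρ) r t))
    (hreg : gam A h.hA - (ρ * ‖s‖ - gam A h.hA) / 2 ≤
      ρ * ‖iterate A bt ρ (stepSize A b ρ) r k‖) :
    potential A b bt s ρ r (k + 1) ≤
      (1 - stepSize A b ρ * (ρ * ‖s‖ - gam A h.hA) / 4) * potential A b bt s ρ r k := by
  have h1 := h.potential_succ_le k
  have h2 := h.gap_ge hε hk ht
  have h3 := h.inner_grad_sub (iterate A bt ρ (stepSize A b ρ) r k)
  have h4 := h.objective_sub (iterate A bt ρ (stepSize A b ρ) r k)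
  have h5 := h.objective_bt_sub (iterate A bt ρ (stepSize A b ρ) r k)
  have h6 := abs_le.1 (h.abs_perturbation_le hε k)
  have h8 := neg_gam_mul_le_inner h.hA (iterate A bt ρ (stepSize A b ρ) r k - s)
  have h9 := h.gam_le hd
  have hρ := h.rho_pos
  have hS := h.norm_pos
  have hη := h.stepSize_pos
  have hκη : stepSize A b ρ * (ρ * ‖s‖ - gam A h.hA) ≤ 1 / 4 := by
    obtain ⟨i, hi⟩ := exists_eigenvalue_eq h.hA hd
    have h10 := (abs_le.1 (abs_eigenvalue_le h.hA i)).2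
    have h11 : ρ * ‖s‖ - gam A h.hA ≤ opNorm A + ρ * radius A b ρ := by
      have := mul_le_mul_of_nonneg_left h.norm_le_radius hρ.le
      linarith
    have := mul_le_mul_of_nonneg_left h11 hη.le
    have := h.stepSize_mul
    linarith
  have hpot : potential A b bt s ρ r k = ‖iterate A bt ρ (stepSize A b ρ) r k - s‖ ^ 2 +
    2 * stepSize A b ρ * (objective A bt ρ (iterate A bt ρ (stepSize A b ρ) r k) -
      objective A bt ρ s) := rfl
  set x := iterate A bt ρ (stepSize A b ρ) r k
  set Q : ℝ := inner ℝ (x - s) (op A (x - s))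
  set Y := ‖x - s‖
  set κ := ρ * ‖s‖ - gam A h.hA with hκ
  have hκ0 : 0 ≤ κ := by linarith
  set w := objective A bt ρ x - objective A bt ρ s
  have h10 : 0 ≤ (ρ * ‖x‖ - (gam A h.hA - κ / 2)) * Y ^ 2 := mul_nonneg (by linarith) (sq_nonneg _)
  have h11 : 0 ≤ ρ * ((‖s‖ - ‖x‖) ^ 2 * (‖s‖ + ‖x‖)) := by positivity
  have h11' : 0 ≤ ρ * ((‖s‖ - ‖x‖) ^ 2 * ‖s‖) := by positivity
  have h12 : 1 / 4 * w + κ / 8 * Y ^ 2 ≤ inner ℝ (grad A bt ρ x) (x - s) + 5 / 32 * ε := by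
    rw [h3]; linarith
  -- The error `5ε/32` is at most `5w/28` because `w ≥ 7ε/8`, and `1/4 - 5/28 = 1/14`.
  have h13 : w / 14 + κ / 8 * Y ^ 2 ≤ inner ℝ (grad A bt ρ x) (x - s) := by linarith
  have h14 := mul_le_mul_of_nonneg_left h13 hη.le
  have h15 : 0 ≤ stepSize A b ρ * w :=
    mul_nonneg hη.le (by linarith [mul_nonneg h.sigma_nonneg hS.le])
  have h16 : 0 ≤ stepSize A b ρ * w * (1 / 4 - stepSize A b ρ * κ) :=
    mul_nonneg h15 (by linarith)
  rw [hpot] at h1 ⊢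
  linarith

/-- The number of steps after the growth phase: sublinear bound. -/
lemma steps_le_sub (h : PerturbedDescent A b ρ s σ q bt r) (hd : 0 < d)
    (hε0 : 0 < ε) (hε : 24 * σ * ‖s‖ ≤ ε) (hεL : ε ≤ smoothness A ρ s * ‖s‖ ^ 2)
    (hμ : 36 * μ * ‖s‖ ^ 2 ≤ ε) (hμ0 : 0 < μ) {N j : ℕ}
    (ht : objective A b ρ s + ε <
      objective A b ρ (iterate A bt ρ (stepSize A b ρ) r (N + j)))
    (hreg : ∀ k, N ≤ k → gam A h.hA - μ ≤ ρ * ‖iterate A bt ρ (stepSize A b ρ) r k‖) :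
    (j : ℝ) ≤ 80 * (smoothness A ρ s * ‖s‖ ^ 2 / ε) := by
  have h1 : ∀ i ≤ j, potential A b bt s ρ r (N + i) ≤
      potential A b bt s ρ r N - i * (stepSize A b ρ * ε) := by
    intro i
    induction i with
    | zero => intro _; simp
    | succ i ih =>
      intro hi
      have h2 := ih (by omega)
      have h3 := h.potential_succ_le_sub hd hε hμ hμ0 (k := N + i) (by omega) ht
        (hreg _ (by omega))
      rw [← add_assoc]
      push_cast
      linarith
  have h2 := h1 j le_rfl
  have h3 := h.potential_le hε hεL N
  have h4 : 0 ≤ potential A b bt s ρ r (N + j) := by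
    have := h.gap_ge hε le_rfl ht
    have h5 := h.stepSize_pos
    exact add_nonneg (sq_nonneg _) (mul_nonneg (by positivity) (by linarith))
  have h5 := mul_le_mul_of_nonneg_right h.one_le_stepSize_mul_smoothness
    (show 0 ≤ (j : ℝ) * ε by positivity)
  have h6 := mul_le_mul_of_nonneg_right (show j * (stepSize A b ρ * ε) ≤ 10 * ‖s‖ ^ 2 by linarith)
    h.smoothness_pos.le
  rw [mul_div_assoc', le_div_iff₀ hε0]
  linarith

/-- The number of steps after the growth phase: linear convergence. -/
lemma steps_le_log (h : PerturbedDescent A b ρ s σ q bt r) (hd : 0 < d)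
    (hε0 : 0 < ε) (hε : 24 * σ * ‖s‖ ≤ ε) (hεL : ε ≤ smoothness A ρ s * ‖s‖ ^ 2)
    (hκ : gam A h.hA < ρ * ‖s‖) {N j : ℕ}
    (ht : objective A b ρ s + ε <
      objective A b ρ (iterate A bt ρ (stepSize A b ρ) r (N + j)))
    (hreg : ∀ k, N ≤ k → gam A h.hA - (ρ * ‖s‖ - gam A h.hA) / 2 ≤
      ρ * ‖iterate A bt ρ (stepSize A b ρ) r k‖) :
    (j : ℝ) ≤ 32 * (smoothness A ρ s / (ρ * ‖s‖ - gam A h.hA)) *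
      Real.log (46 * (smoothness A ρ s * ‖s‖ ^ 2 / ε)) := by
  have hη := h.stepSize_pos
  have hL := h.smoothness_pos
  have hS := h.norm_pos
  set κ := ρ * ‖s‖ - gam A h.hA with hκdef
  have hκ0 : 0 < κ := sub_pos.2 hκ
  have hexp : ∀ i ≤ j, potential A b bt s ρ r (N + i) ≤
      Real.exp (-(i * (stepSize A b ρ * κ / 4))) * (10 * ‖s‖ ^ 2) := by
    intro i
    induction i with
    | zero => intro _; simpa using h.potential_le hε hεL N
    | succ i ih =>
      intro hi
      have h2 := ih (by omega)
      have h3 := h.potential_succ_le_mul hd hε (k := N + i) (by omega) ht (hreg _ (by omega))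
      have h0 : 0 ≤ potential A b bt s ρ r (N + i) := by
        have := h.gap_ge hε (show N + i ≤ N + j by omega) ht
        exact add_nonneg (sq_nonneg _) (mul_nonneg (by positivity) (by linarith))
      have h4 := Real.add_one_le_exp (-(stepSize A b ρ * κ / 4))
      have e : -(((i + 1 : ℕ) : ℝ) * (stepSize A b ρ * κ / 4)) =
          -(stepSize A b ρ * κ / 4) + -(i * (stepSize A b ρ * κ / 4)) := by push_cast; ring
      rw [← add_assoc, e, Real.exp_add, mul_assoc]
      calc _ ≤ _ := h3
        _ ≤ Real.exp (-(stepSize A b ρ * κ / 4)) * potential A b bt s ρ r (N + i) :=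
            mul_le_mul_of_nonneg_right (by linarith) h0
        _ ≤ _ := mul_le_mul_of_nonneg_left h2 (Real.exp_pos _).le
  have h1 := hexp j le_rfl
  have h2 : 7 / 4 * (stepSize A b ρ * ε) ≤ potential A b bt s ρ r (N + j) := by
    have h3 := mul_le_mul_of_nonneg_left (h.gap_ge hε le_rfl ht) hη.le
    have := sq_nonneg ‖iterate A bt ρ (stepSize A b ρ) r (N + j) - s‖
    unfold potential
    linarith
  set ξ := j * (stepSize A b ρ * κ / 4) with hξ
  have h3 : Real.exp ξ * (7 / 4 * (stepSize A b ρ * ε)) ≤ 10 * ‖s‖ ^ 2 := by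
    have h4 := mul_le_mul_of_nonneg_left (h2.trans h1) (Real.exp_pos ξ).le
    rwa [← mul_assoc (Real.exp ξ) (Real.exp (-ξ)), ← Real.exp_add, add_neg_cancel, Real.exp_zero, one_mul] at h4
  have h8 := h.one_le_stepSize_mul_smoothness
  have h4 : Real.exp ξ ≤ 46 * (smoothness A ρ s * ‖s‖ ^ 2 / ε) := by
    rw [mul_div_assoc', le_div_iff₀ hε0]
    have h5 := mul_le_mul_of_nonneg_right h8 (mul_pos (Real.exp_pos ξ) hε0).le
    have h6 := mul_le_mul_of_nonneg_right h3 hL.le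
    have h7 : 0 ≤ smoothness A ρ s * ‖s‖ ^ 2 := by positivity
    linarith
  have h5 : ξ ≤ Real.log (46 * (smoothness A ρ s * ‖s‖ ^ 2 / ε)) :=
    (Real.le_log_iff_exp_le (by positivity)).2 h4
  have h6 : (j : ℝ) * κ ≤ 32 * smoothness A ρ s * ξ := by
    have h7 := mul_le_mul_of_nonneg_right h8 (show 0 ≤ (j : ℝ) * κ by positivity)
    rw [hξ]
    linarith
  have h7 : (j : ℝ) ≤ 32 * (smoothness A ρ s / κ) * ξ := by
    rw [mul_div_assoc', div_mul_eq_mul_div, le_div_iff₀ hκ0]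
    exact h6
  exact h7.trans (mul_le_mul_of_nonneg_left h5 (by positivity))

/-- The growth phase. -/
lemma exists_growth_time (h : PerturbedDescent A b ρ s σ q bt r) {i : Fin d}
    (hi : h.hA.eigenvalues i = -gam A h.hA) (hγ : 0 < gam A h.hA)
    {β₁ : ℝ} (hβ₁ : 0 < β₁) (hb : β₁ ≤ |inner ℝ (h.hA.eigenvectorBasis i) bt|) (hμ : 0 < μ) :
    ∃ N : ℕ, (N : ℝ) ≤ 16 * (smoothness A ρ s / μ) *
        Real.log (1 + gam A h.hA ^ 2 / (ρ * β₁)) + 1 ∧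
      ∀ k, N ≤ k → gam A h.hA - μ ≤ ρ * ‖iterate A bt ρ (stepSize A b ρ) r k‖ := by
  have hη := h.stepSize_pos
  have hL := h.smoothness_pos
  have hρ := h.rho_pos
  set W := 1 + gam A h.hA ^ 2 / (ρ * β₁)
  have hW : 1 < W := lt_add_of_pos_right _ (by positivity)
  have hlog : 0 < Real.log W := Real.log_pos hW
  set T := 16 * (smoothness A ρ s / μ) * Real.log W with hT
  have hT0 : 0 < T := by positivity
  refine ⟨⌈T⌉₊, (Nat.ceil_lt_add_one hT0.le).le, fun k hk => ?_⟩
  by_contra hc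
  push Not at hc
  have h1 := h.pow_le_of_norm_lt hi hβ₁ hb hμ hc
  have hkT : T ≤ k := (Nat.le_ceil T).trans (by exact_mod_cast hk)
  set y := stepSize A b ρ * μ with hy
  have hy0 : 0 < y := by positivity
  have hy1 : y ≤ 1 / 2 := by
    have h2 : μ ≤ opNorm A := by
      have h3 := (abs_le.1 (abs_eigenvalue_le h.hA i)).1
      have h4 := mul_nonneg hρ.le (norm_nonneg (iterate A bt ρ (stepSize A b ρ) r k))
      linarith
    have h3 : μ ≤ smoothness A ρ s := by
      have := mul_pos hρ h.norm_pos
      unfold smoothness; linarith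
    exact (mul_le_mul_of_nonneg_left h3 hη.le).trans h.stepSize_mul_smoothness_le
  have h2 := Real.log_le_log (by positivity) h1
  rw [Real.log_pow] at h2
  -- The strict inequality makes the chosen time contradictory even when `T` is itself an integer.
  have h3 : y / 2 < Real.log (1 + y) := by
    have h4 := Real.one_sub_inv_le_log_of_pos (show 0 < 1 + y by linarith)
    have h5 : y / 2 < 1 - (1 + y)⁻¹ := by
      have e : 1 - (1 + y)⁻¹ = y / (1 + y) := by field_simp; ring
      rw [e, lt_div_iff₀ (by linarith)]
      nlinarith
    linarith
  have hk0 : (0 : ℝ) < k := hT0.trans_le hkT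
  have h4 : k * (y / 2) < Real.log W := (mul_lt_mul_of_pos_left h3 hk0).trans_le h2
  have h5 : T * (y / 2) ≤ k * (y / 2) := mul_le_mul_of_nonneg_right hkT (by positivity)
  have h6 : T * (y / 2) = 8 * (stepSize A b ρ * smoothness A ρ s) * Real.log W := by
    rw [hT, hy]; field_simp; ring
  have h7 := mul_le_mul_of_nonneg_right h.one_le_stepSize_mul_smoothness hlog.le
  linarith

end PerturbedDescent

end CubicGD

/-! ### Adding the two phases, and the probability of a bad perturbation. -/

namespace CubicGD

variable {d : ℕ} {A : Matrix (Fin d) (Fin d) ℝ} {b s q bt : E d} {ρ r ε δ : ℝ}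

/-- The factor of `iterBound` in front of the logarithm. -/
noncomputable def rateFactor (A : Matrix (Fin d) (Fin d) ℝ) (hA : A.IsHermitian) (ρ : ℝ) (s : E d)
    (ε : ℝ) : ℝ :=
  if gam A hA < ρ * ‖s‖ then
      min (smoothness A ρ s / (ρ * ‖s‖ - gam A hA)) (smoothness A ρ s * ‖s‖ ^ 2 / ε)
    else smoothness A ρ s * ‖s‖ ^ 2 / ε

/-- The argument of the logarithm of `iterBound`. -/
noncomputable def logArg (A : Matrix (Fin d) (Fin d) ℝ) (hA : A.IsHermitian) (ρ : ℝ) (s : E d)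
    (ε δ : ℝ) : ℝ :=
  (1 + if 0 < gam A hA then (d : ℝ) / δ else 0) * (smoothness A ρ s * ‖s‖ ^ 2 / ε)

lemma le_logArg (hA : A.IsHermitian) (hδ : 0 < δ) (hX : 0 ≤ smoothness A ρ s * ‖s‖ ^ 2 / ε) :
    smoothness A ρ s * ‖s‖ ^ 2 / ε ≤ logArg A hA ρ s ε δ := by
  refine le_mul_of_one_le_left hX (le_add_of_nonneg_right ?_)
  split_ifs <;> positivity

lemma sigma_one_eq (A : Matrix (Fin d) (Fin d) ℝ) (ρ : ℝ) (s : E d) (ε : ℝ) :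
    sigma A ρ s ε 1 = ρ * ε / (12 * smoothness A ρ s) := by
  rw [sigma, div_mul_div_comm, mul_one, mul_comm 12, smoothness]

namespace PerturbedDescent

lemma one_le_rateFactor (h : PerturbedDescent A b ρ s (sigma A ρ s ε 1) q bt r) (hd : 0 < d)
    (hε0 : 0 < ε) (hεL : ε ≤ smoothness A ρ s * ‖s‖ ^ 2) : 1 ≤ rateFactor A h.hA ρ s ε := by
  have hX : 1 ≤ smoothness A ρ s * ‖s‖ ^ 2 / ε := by rwa [le_div_iff₀ hε0, one_mul]
  unfold rateFactor
  split_ifs with hκ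
  · refine le_min ?_ hX
    rw [le_div_iff₀ (sub_pos.2 hκ), one_mul]
    obtain ⟨i, hi⟩ := exists_eigenvalue_eq h.hA hd
    have h10 := (abs_le.1 (abs_eigenvalue_le h.hA i)).2
    have := mul_pos h.rho_pos h.norm_pos
    unfold smoothness; linarith
  · exact hX

lemma sigma_mul_smoothness (h : PerturbedDescent A b ρ s (sigma A ρ s ε 1) q bt r) :
    sigma A ρ s ε 1 * (12 * smoothness A ρ s) = ρ * ε := by
  have := h.smoothness_pos.ne'
  rw [sigma_one_eq, div_mul_cancel₀ _ (by positivity)]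

/-- Inserting `σ` and `γ ≤ ρ‖s‖` bounds the quotient by `12 * 6912` times `(L_s‖s‖²/ε)(d/δ)²`, which
is at most quadratic in the argument of the logarithm of `iterBound`. -/
lemma log_growth_le (h : PerturbedDescent A b ρ s (sigma A ρ s ε 1) q bt r) (hd : 0 < d)
    (hε0 : 0 < ε) (hδ : 0 < δ) (hγ : 0 < gam A h.hA)
    (hX : 1 ≤ smoothness A ρ s * ‖s‖ ^ 2 / ε) :
    Real.log (1 + gam A h.hA ^ 2 / (ρ * (sigma A ρ s ε 1 * (δ ^ 2 / (6912 * d ^ 2))))) ≤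
      12 + 2 * Real.log (logArg A h.hA ρ s ε δ) := by
  have hL := h.smoothness_pos
  have hρ := h.rho_pos
  have hS := h.norm_pos
  have hdR : (0 : ℝ) < d := Nat.cast_pos.2 hd
  have hσ := h.sigma_mul_smoothness
  have hσ0 : 0 < sigma A ρ s ε 1 := by
    have : 0 < sigma A ρ s ε 1 * (12 * smoothness A ρ s) := hσ ▸ mul_pos hρ hε0
    exact pos_of_mul_pos_left this (by positivity)
  set X := smoothness A ρ s * ‖s‖ ^ 2 / ε with hXdef
  have hγ2 : gam A h.hA ^ 2 ≤ (ρ * ‖s‖) ^ 2 := pow_le_pow_left₀ hγ.le (h.gam_le hd) 2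
  have h1 : gam A h.hA ^ 2 / (ρ * (sigma A ρ s ε 1 * (δ ^ 2 / (6912 * d ^ 2)))) ≤
      82944 * (X * (d / δ) ^ 2) := by
    rw [div_le_iff₀ (by positivity)]
    refine hγ2.trans (le_of_eq ?_)
    have e : ρ * (sigma A ρ s ε 1) = ρ * (ρ * ε / (12 * smoothness A ρ s)) := by
      rw [← hσ]; field_simp
    rw [← mul_assoc ρ, e, hXdef]
    field_simp
    norm_num
  have h2 : logArg A h.hA ρ s ε δ = (1 + d / δ) * X := by rw [logArg, if_pos hγ]
  have hp : 0 < (d : ℝ) / δ := by positivity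
  have h3 : 1 + 82944 * (X * (d / δ) ^ 2) ≤ 82945 * logArg A h.hA ρ s ε δ ^ 2 := by
    rw [h2]
    have h4 : 1 ≤ ((1 + d / δ) * X) ^ 2 :=
      one_le_pow₀ (one_le_mul_of_one_le_of_one_le (by linarith) hX)
    have h5 : X * (d / δ) ^ 2 ≤ ((1 + d / δ) * X) ^ 2 := by
      rw [mul_pow, mul_comm X]
      exact mul_le_mul (pow_le_pow_left₀ hp.le (by linarith) 2) (by nlinarith) (by linarith)
        (by positivity)
    linarith
  have hW : 0 < logArg A h.hA ρ s ε δ := by rw [h2]; positivity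
  refine (Real.log_le_log (by positivity) ((add_le_add le_rfl h1).trans h3)).trans ?_
  rw [Real.log_mul (by norm_num) (by positivity), Real.log_pow]
  have h6 : Real.log 82945 ≤ 12 := by
    rw [Real.log_le_iff_le_exp (by norm_num)]
    have h7 : Real.exp 12 = Real.exp 1 ^ 12 := by rw [← Real.exp_nat_mul]; norm_num
    rw [h7]
    calc (82945 : ℝ) ≤ 2.7 ^ 12 := by norm_num
      _ ≤ _ := pow_le_pow_left₀ (by norm_num) (by linarith [Real.exp_one_gt_d9]) _
  push_cast
  linarith

/-- The deterministic convergence guarantee: a perturbation with a component along the bottom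
eigenvector that is not too small suffices. -/
theorem objective_le_of_iterBound_le
    (h : PerturbedDescent A b ρ s (sigma A ρ s ε 1) q bt r) (hd : 0 < d)
    (hε0 : 0 < ε) (hεL : ε ≤ smoothness A ρ s * ‖s‖ ^ 2) (hδ : 0 < δ)
    (hgood : 0 < gam A h.hA → ∃ i, h.hA.eigenvalues i = -gam A h.hA ∧
      sigma A ρ s ε 1 * (δ ^ 2 / (6912 * d ^ 2)) ≤ |inner ℝ (h.hA.eigenvectorBasis i) bt|)
    {t : ℕ} (ht : 20000 * iterBound A h.hA ρ s ε δ ≤ t) :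
    objective A b ρ (iterate A bt ρ (stepSize A b ρ) r t) ≤ objective A b ρ s + ε := by
  by_contra hc
  push Not at hc
  have hL := h.smoothness_pos
  have hρ := h.rho_pos
  have hS := h.norm_pos
  have hdR : (0 : ℝ) < d := Nat.cast_pos.2 hd
  have hσ := h.sigma_mul_smoothness
  have hσ0 : 0 < sigma A ρ s ε 1 := by
    have : 0 < sigma A ρ s ε 1 * (12 * smoothness A ρ s) := hσ ▸ mul_pos hρ hε0
    exact pos_of_mul_pos_left this (by positivity)
  have hε : 24 * sigma A ρ s ε 1 * ‖s‖ ≤ ε := by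
    have h1 : 2 * ρ * ‖s‖ ≤ smoothness A ρ s := le_add_of_nonneg_left opNorm_nonneg
    have h2 := mul_le_mul_of_nonneg_left h1 hσ0.le
    have h3 : ρ * (24 * sigma A ρ s ε 1 * ‖s‖) ≤ ρ * ε := by linarith
    exact le_of_mul_le_mul_left h3 hρ
  have hX := h.five_mul_le hε hc
  have hbound : iterBound A h.hA ρ s ε δ =
    rateFactor A h.hA ρ s ε * Real.log (logArg A h.hA ρ s ε δ) := rfl
  rw [hbound] at ht
  have hM1 := h.one_le_rateFactor hd hε0 hεL
  have hX53 : 5 / 3 ≤ smoothness A ρ s * ‖s‖ ^ 2 / ε := by rw [le_div_iff₀ hε0]; linarith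
  have hXW := le_logArg h.hA (ρ := ρ) (s := s) (ε := ε) hδ (by linarith)
  have hgrowth := h.log_growth_le (δ := δ) hd hε0 hδ
  set X := smoothness A ρ s * ‖s‖ ^ 2 / ε with hXdef
  set M := rateFactor A h.hA ρ s ε with hM
  set Λ := Real.log (logArg A h.hA ρ s ε δ) with hΛ
  have hlogX : Real.log X ≤ Λ := Real.log_le_log (by linarith) hXW
  -- The logarithm may vanish, at `ε = L_s‖s‖²`, and could then not absorb additive constants. A
  -- failure at time `t` excludes this by `five_mul_le`.
  have hΛ1 : 2 / 5 ≤ Λ := by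
    have h1 := Real.one_sub_inv_le_log_of_pos (show 0 < X by linarith)
    have h2 : X⁻¹ ≤ (5 / 3 : ℝ)⁻¹ := inv_anti₀ (by norm_num) hX53
    norm_num at h2
    linarith
  have hΛM : Λ ≤ M * Λ := le_mul_of_one_le_left (by linarith) hM1
  -- The threshold depends on which term attains the minimum: half of `ρ‖s‖ - γ` for linear
  -- convergence, `ε / (36‖s‖²)` for the sublinear rate.
  obtain ⟨μ, hμ0, hμM, hconv⟩ : ∃ μ : ℝ, 0 < μ ∧ smoothness A ρ s / μ ≤ 36 * M ∧
      ∀ N, (∀ k, N ≤ k → gam A h.hA - μ ≤ ρ * ‖iterate A bt ρ (stepSize A b ρ) r k‖) →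
        N ≤ t → ((t - N : ℕ) : ℝ) ≤ 352 * (M * Λ) := by
    by_cases hcase : gam A h.hA < ρ * ‖s‖ ∧
        smoothness A ρ s / (ρ * ‖s‖ - gam A h.hA) ≤ X
    · obtain ⟨hκ, hle⟩ := hcase
      have hMe : M = smoothness A ρ s / (ρ * ‖s‖ - gam A h.hA) := by
        rw [hM, rateFactor, if_pos hκ, min_eq_left hle]
      refine ⟨(ρ * ‖s‖ - gam A h.hA) / 2, half_pos (sub_pos.2 hκ), ?_, fun N hreg hN => ?_⟩
      · have e : smoothness A ρ s / ((ρ * ‖s‖ - gam A h.hA) / 2) = 2 * M := by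
          rw [hMe]; field_simp
        rw [e]; linarith
      · have h1 := h.steps_le_log hd hε0 hε hεL hκ (N := N) (j := t - N)
          (by rwa [Nat.add_sub_cancel' hN]) hreg
        rw [← hMe, ← hXdef, Real.log_mul (by norm_num) (by linarith)] at h1
        have h2 : Real.log 46 ≤ 4 := by
          rw [Real.log_le_iff_le_exp (by norm_num)]
          have h7 : Real.exp 4 = Real.exp 1 ^ 4 := by rw [← Real.exp_nat_mul]; norm_num
          rw [h7]
          calc (46 : ℝ) ≤ 2.7 ^ 4 := by norm_num
            _ ≤ _ := pow_le_pow_left₀ (by norm_num) (by linarith [Real.exp_one_gt_d9]) _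
        have h3 : 32 * M * (Real.log 46 + Real.log X) ≤ 32 * M * (11 * Λ) :=
          mul_le_mul_of_nonneg_left (by linarith) (by linarith)
        linarith
    · have hMe : M = X := by
        rw [hM, rateFactor]
        split_ifs with hκ
        · exact min_eq_right (not_le.1 fun hle => hcase ⟨hκ, hle⟩).le
        · rfl
      have hS2 : 0 < ‖s‖ ^ 2 := by positivity
      refine ⟨ε / (36 * ‖s‖ ^ 2), by positivity, ?_, fun N hreg hN => ?_⟩
      · refine le_of_eq ?_
        rw [hMe, hXdef]; field_simp
      · have h1 := h.steps_le_sub hd hε0 hε hεL (μ := ε / (36 * ‖s‖ ^ 2))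
          (le_of_eq (by field_simp)) (by positivity) (N := N) (j := t - N)
          (by rwa [Nat.add_sub_cancel' hN]) hreg
        rw [← hXdef, ← hMe] at h1
        have h2 := mul_le_mul_of_nonneg_left hΛ1 (show 0 ≤ M by linarith)
        linarith
  -- The constant is `16 * 36 * 32` plus room for the final `1` from rounding up. With the `352` of
  -- the convergence phase the total stays below `20000`.
  obtain ⟨N, hNle, hreg⟩ : ∃ N : ℕ, (N : ℝ) ≤ 18435 * (M * Λ) ∧
      ∀ k, N ≤ k → gam A h.hA - μ ≤ ρ * ‖iterate A bt ρ (stepSize A b ρ) r k‖ := by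
    rcases le_or_gt (gam A h.hA) 0 with hγ | hγ
    · refine ⟨0, by rw [Nat.cast_zero]; linarith, fun k _ => ?_⟩
      have := mul_nonneg hρ.le (norm_nonneg (iterate A bt ρ (stepSize A b ρ) r k))
      linarith
    · obtain ⟨i, hi, hb⟩ := hgood hγ
      obtain ⟨N, hN, hreg⟩ := h.exists_growth_time hi hγ (by positivity) hb hμ0
      refine ⟨N, hN.trans ?_, hreg⟩
      have h1 := hgrowth hγ (by linarith)
      have h2 : 16 * (smoothness A ρ s / μ) * Real.log (1 + gam A h.hA ^ 2 /
          (ρ * (sigma A ρ s ε 1 * (δ ^ 2 / (6912 * d ^ 2))))) ≤ 16 * (36 * M) * (32 * Λ) := by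
        refine mul_le_mul (by linarith) (by linarith) (Real.log_nonneg ?_) (by linarith)
        exact le_add_of_nonneg_right (by positivity)
      linarith
  have hNt : N ≤ t := by
    have : (N : ℝ) ≤ t := by linarith
    exact_mod_cast this
  have h1 := hconv N hreg hNt
  rw [Nat.cast_sub hNt] at h1
  linarith

end PerturbedDescent

/-- With probability at least `1 - δ`, the perturbed linear term is not nearly orthogonal to a
given unit vector. -/
lemma prob_inner_ge {Ω : Type*} [MeasurableSpace Ω] {P : Measure Ω} [IsProbabilityMeasure P]
    {q : Ω → Metric.sphere (0 : E d) 1} (hq : HasLaw q (uniformSphere d) P) (hd : 0 < d)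
    {v u : E d} (hv : ‖v‖ = 1) (hu : ‖u‖ = 1) (hvu : (inner ℝ v u : ℝ) = 0) (b : E d) {σ : ℝ}
    (hσ : 0 < σ) (hδ : 0 < δ) (hδ1 : δ ≤ 1) :
    P.real {ω | |inner ℝ v (b + σ • (q ω : E d))| < σ * (δ ^ 2 / (6912 * d ^ 2))} ≤ δ := by
  have hdR : (1 : ℝ) ≤ d := by exact_mod_cast hd
  set τ := δ ^ 2 / (6912 * (d : ℝ) ^ 2) with hτ
  have hτ0 : 0 < τ := by positivity
  have hτ1 : τ < 1 := by
    rw [hτ, div_lt_one (by positivity)]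
    nlinarith
  set a : ℝ := -(inner ℝ v b / σ) with ha
  set B : Set (Metric.sphere (0 : E d) 1) := {q | |inner ℝ v (q : E d) - a| ≤ τ} with hB
  have hsub : {ω | |inner ℝ v (b + σ • (q ω : E d))| < σ * τ} ⊆ q ⁻¹' B := fun ω hω => by
    have e : (inner ℝ v (b + σ • (q ω : E d)) : ℝ) = σ * (inner ℝ v (q ω : E d) - a) := by
      rw [inner_add_right, real_inner_smul_right, ha]
      field_simp
      ring
    change |inner ℝ v (b + σ • (q ω : E d))| < σ * τ at hω
    rw [e, abs_mul, abs_of_pos hσ] at hω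
    exact (lt_of_mul_lt_mul_left hω hσ.le).le
  have hBm : MeasurableSet B := (isClosed_le (by fun_prop) (by fun_prop)).measurableSet
  have hlaw : P.real (q ⁻¹' B) = (uniformSphere d).real B := by
    rw [measureReal_def, measureReal_def, ← hq.map_eq,
      Measure.map_apply_of_aemeasurable hq.aemeasurable hBm]
  refine (measureReal_mono hsub).trans ?_
  rw [hlaw]
  rcases le_or_gt |a| 2 with h2 | h2
  · refine (uniformSphere_band_le hd hv hu hvu h2 hτ0).trans (le_of_eq ?_)
    -- The constant `6912 = 12 * 24²` makes the band probability exactly `δ`.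
    have e : 12 * τ = (δ / (24 * d)) ^ 2 := by
      rw [hτ]; field_simp; norm_num
    rw [e, Real.sqrt_sq (by positivity)]
    field_simp
  · have : B = ∅ := by
      refine Set.eq_empty_of_forall_notMem fun x hx => ?_
      change |inner ℝ v (x : E d) - a| ≤ τ at hx
      have h3 : |inner ℝ v (x : E d)| ≤ 1 := by
        simpa [hv] using abs_real_inner_le_norm v (x : E d)
      have h4 := abs_sub_abs_le_abs_sub a (inner ℝ v (x : E d))
      rw [abs_sub_comm] at h4
      linarith
    rw [this, measureReal_empty]
    exact hδ.le

end CubicGD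

theorem corollary3 :
    ∃ C : ℝ, 0 < C ∧
      ∀ (d : ℕ), 2 ≤ d →
      ∀ (A : Matrix (Fin d) (Fin d) ℝ) (hA : A.IsHermitian) (b : CubicGD.E d) (ρ : ℝ), 0 < ρ →
      ∀ (s : CubicGD.E d), IsMinOn (CubicGD.objective A b ρ) Set.univ s →
      ∀ (ε δ : ℝ), 0 < ε → ε ≤ CubicGD.smoothness A ρ s * ‖s‖ ^ 2 → 0 < δ →
      ∀ (Ω : Type*) [MeasurableSpace Ω] (P : Measure Ω) [IsProbabilityMeasure P]
        (q : Ω → Metric.sphere (0 : CubicGD.E d) 1), HasLaw q (CubicGD.uniformSphere d) P →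
      ∀ (btilde : Ω → CubicGD.E d),
        (∀ ω, btilde ω = b + CubicGD.sigma A ρ s ε 1 • (q ω : CubicGD.E d)) →
      ∀ (r : Ω → ℝ), Measurable r →
        (∀ ω, 0 ≤ r ω ∧ r ω ≤ CubicGD.cauchyRadius A (btilde ω) ρ) →
        1 - δ ≤ P.real {ω | ∀ t : ℕ, C * CubicGD.iterBound A hA ρ s ε δ ≤ t →
          CubicGD.objective A b ρ
              (CubicGD.iterate A (btilde ω) ρ (CubicGD.stepSize A b ρ) (r ω) t) ≤
            CubicGD.objective A b ρ s + ε} := by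
  refine ⟨20000, by norm_num, ?_⟩
  intro d hd A hA b ρ hρ s hs ε δ hε0 hεL hδ Ω _ P _ q hq btilde hbt r _ hr
  rcases lt_or_ge 1 δ with hδ1 | hδ1
  · exact (show 1 - δ ≤ 0 by linarith).trans measureReal_nonneg
  have hd0 : 0 < d := by omega
  have hs0 : s ≠ 0 := by
    rintro rfl
    simp at hεL
    linarith
  have hS : 0 < ‖s‖ := norm_pos_iff.2 hs0
  have hL : 0 < CubicGD.smoothness A ρ s := by
    have := mul_pos hρ hS
    have := CubicGD.opNorm_nonneg (A := A)
    unfold CubicGD.smoothness; linarith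
  have hσe := CubicGD.sigma_one_eq A ρ s ε
  have hσ0 : 0 < CubicGD.sigma A ρ s ε 1 := by rw [hσe]; positivity
  have hdesc : ∀ ω, CubicGD.PerturbedDescent A b ρ s (CubicGD.sigma A ρ s ε 1) (q ω) (btilde ω)
      (r ω) := fun ω =>
    { hA := hA
      rho_pos := hρ
      isMinOn := hs
      ne_zero := hs0
      sigma_nonneg := hσ0.le
      sigma_le := by
        rw [hσe, mul_div_assoc', div_le_iff₀ (by positivity)]
        nlinarith [mul_le_mul_of_nonneg_left hεL hρ.le]
      norm_q := (norm_eq_of_mem_sphere (q ω)).le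
      bt_eq := hbt ω
      r_nonneg := (hr ω).1
      r_le := (hr ω).2 }
  obtain ⟨i, hi⟩ := CubicGD.exists_eigenvalue_eq hA hd0
  obtain ⟨j, hij⟩ : ∃ j : Fin d, i ≠ j := by
    have : Nontrivial (Fin d) := Fin.nontrivial_iff_two_le.2 hd
    obtain ⟨j, hj⟩ := exists_ne i
    exact ⟨j, hj.symm⟩
  have hbad := CubicGD.prob_inner_ge hq hd0 (hA.eigenvectorBasis.orthonormal.1 i)
    (hA.eigenvectorBasis.orthonormal.1 j) (hA.eigenvectorBasis.orthonormal.2 hij) b hσ0 hδ hδ1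
  set S := {ω | ∀ t : ℕ, 20000 * CubicGD.iterBound A hA ρ s ε δ ≤ t →
    CubicGD.objective A b ρ
        (CubicGD.iterate A (btilde ω) ρ (CubicGD.stepSize A b ρ) (r ω) t) ≤
      CubicGD.objective A b ρ s + ε}
  set B := {ω | |inner ℝ (hA.eigenvectorBasis i) (b + CubicGD.sigma A ρ s ε 1 •
    (q ω : CubicGD.E d))| < CubicGD.sigma A ρ s ε 1 * (δ ^ 2 / (6912 * d ^ 2))}
  -- The bad event involves neither `t` nor `r`, so one exclusion serves all times and any random
  -- radius. Subadditivity avoids measurability of `S`.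
  have hcover : Set.univ ⊆ S ∪ B := fun ω _ => by
    by_cases hω : ω ∈ B
    · exact Or.inr hω
    · refine Or.inl fun t ht => ?_
      refine (hdesc ω).objective_le_of_iterBound_le hd0 hε0 hεL hδ (fun _ => ⟨i, hi, ?_⟩) ht
      have h2 := congrArg (fun x => |inner ℝ (hA.eigenvectorBasis i) x|) (hbt ω)
      exact (not_lt.1 hω).trans_eq h2.symm
  have h1 := (measureReal_mono (μ := P) hcover).trans (measureReal_union_le S B)
  rw [probReal_univ] at h1
  linarith
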